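/- **Theorem 5.13 (Algebraic Structure II).** Let $\mathscr P=\{\mathscr P_{n,\pm}\}_{n\ge 0}$ be a $C^*$-planar algebra, that is, a shaded planar $*$-algebra in which every $n$-box space $\mathscr P_{n,\pm}$ is a finite-dimensional $C^*$-algebra, together with linear functionals on $\mathscr P_{0,\pm}$ for which the induced functionals $tr_{n,\pm}$ on $n$-boxes (join the top strings of the box to its bottom strings around the right of the box, then apply the functional on $\mathscr P_{0,\pm}$) are faithful and positive. Diagrams are read from bottom to top: $xy$ has $x$ below $y$. Write $\overline y$ for the rotation of a 1-box $y$ by $180^\circ$, $u\otimes v$ for horizontal juxtaposition, $\widehat x$ for the clockwise rotation of a 2-box $x$ by $90^\circ$ (the Fourier transform), $y*z$ for the convolution (the rightmost string of $y$ is joined to the leftmost string of $z$ at the top and at the bottom), and $\mathcal R(a)$ for the range projection of a positive element $a$. Let $x\in\mathscr P_{2,\pm}$ be $\mathfrak F$-positive, i.e. $\widehat x\ge 0$ in $\mathscr P_{2,\mp}$, let $r$ be the spectral radius of $x$, and put $$\mathcal E=\{y\in\mathscr P_{1,\pm}:\ y*\widehat x=r\,y\}.$$ For a set $S$ of $1$-boxes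 let $S^+$ be the set of positive elements of $S$. Then $\{\mathcal R(y): y\in\mathcal E^+\}$ has a largest element $p=p_{\max}$, and the limit $$\zeta=\lim_{z\to r^+}(z-r)\sum_{j=0}^\infty \frac{p*\widehat x^{\,*j}}{z^{j+1}}$$ exists (here $p*\widehat x^{\,*0}=p$, and the series converges for every real $z>r$). Let $x_p=(p\otimes\overline p)\,x\,(p\otimes\overline p)$ and $$\mathcal A_p=\{y\in\mathscr P_{1,\pm}:\ x_p(1\otimes\overline y)=(1\otimes\overline y)x_p\},\qquad \mathcal B_p=\{y\in\mathscr P_{1,\pm}:\ x_p(y\otimes 1)=(y\otimes 1)x_p\}.$$ Suppose that there is a right PF eigenvector $y_1$ of $x$, i.e. a nonzero positive $y_1\in\mathscr P_{1,\mp}$ with $\widehat x*y_1=r\,y_1$, such that $p\wedge\overline{\mathcal R(y_1)}^{\perp}=0$, where $q^\perp=1-q$. Then $$\mathcal E^+=(\mathcal A_p\,\zeta)^+=(\zeta\,\mathcal B_p)^+,$$ where $\mathcal A_p\zeta=\{v\zeta: v\in\mathcal A_p\}$ and $\zeta\mathcal B_p=\{\zeta v: v\in\mathcal B_p\}$. 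-/

import Mathlib

open Filter Topology

universe u

/-- The shading of the region reached from a region of shading `s` by crossing `m` strings.
Here `false` stands for an unshaded region (the sign `+`) and `true` for a shaded one (the sign `-`). -/
def sh (s : Bool) : ℕ → Bool
  | 0 => s
  | m + 1 => !(sh s m)

@[simp] theorem sh_zero (s : Bool) : sh s 0 = s := rfl

@[simp] theorem sh_one (s : Bool) : sh s 1 = !s := rfl

@[simp] theorem sh_two (s : Bool) : sh s 2 = s := by cases s <;> rfl

@[simp] theorem sh_add (s : Bool) (m n : ℕ) : sh s (m + n) = sh (sh s m) n := by
  induction n with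
  | zero => rfl
  | succ n ih => exact congrArg (!·) ih

@[simp] theorem sh_not (s : Bool) (m : ℕ) : sh (!s) m = !(sh s m) := by
  induction m with
  | zero => rfl
  | succ n ih => simp only [sh, ih]

@[simp] theorem sh_sh (s : Bool) (m : ℕ) : sh (sh s m) m = s := by
  induction m with
  | zero => rfl
  | succ n ih => simp only [sh, sh_not, ih, Bool.not_not]

theorem shade_one (s : Bool) : (!s) = sh s 1 := rfl

theorem shade_one_not (s : Bool) : s = sh (!s) 1 := by simp

theorem shade_two (s : Bool) : s = sh s 2 := by simp

theorem shade_two_not (s : Bool) : (!s) = sh (!s) 2 := by simp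

theorem shade_three_not (s : Bool) : s = sh (!s) 3 := by cases s <;> rfl

theorem shade_double (s : Bool) (n : ℕ) : s = sh s (n + n) := by simp

theorem shade_insert (s : Bool) (n : ℕ) : (!s) = sh s (1 + (n + n)) := by
  rw [sh_add, ← shade_double, sh_one]

/-- The operations of a shaded planar `*`-algebra, for diagrams drawn in rectangles.

`Hom s m n` is the space of boxes with `m` strings at the bottom, `n` strings at the top, and a
leftmost region of shading `s` (the marked interval is on the left); crossing a string changes the
shading.  The operations are vertical stacking, horizontal juxtaposition, the vertical reflection,
and the diagrams consisting of through strings or of one cup.  Every planar tangle, put in general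
position, is obtained by stacking and juxtaposing input boxes, through strings, cups and caps. -/
structure PlanarOperations where
  /-- boxes with `m` bottom and `n` top strings -/
  Hom : Bool → ℕ → ℕ → Type u
  [addCommGroup : ∀ s m n, AddCommGroup (Hom s m n)]
  [module : ∀ s m n, Module ℂ (Hom s m n)]
  /-- `n` through strings -/
  strings : ∀ s n, Hom s n n
  /-- vertical stacking, the first argument being at the bottom -/
  stack : ∀ {s m n k}, Hom s m n →ₗ[ℂ] Hom s n k →ₗ[ℂ] Hom s m k
  /-- horizontal juxtaposition, the first argument being on the left.  The region between the two
  boxes has shading `t`, and the total numbers of strings `M` and `N` are free up to a proved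
  equality, so that associativity needs no transport. -/
  beside : ∀ {s t m n m' n' M N}, t = sh s m → M = m + m' → N = n + n' →
    (Hom s m n →ₗ[ℂ] Hom t m' n' →ₗ[ℂ] Hom s M N)
  /-- vertical reflection -/
  adj : ∀ {s m n}, Hom s m n →ₗ⋆[ℂ] Hom s n m
  /-- the cup, in a region of shading `s` -/
  cup : ∀ s, Hom s 0 2

attribute [instance] PlanarOperations.addCommGroup PlanarOperations.module

namespace PlanarOperations

variable (P : PlanarOperations.{u})

/-- The cap, in a region of shading `s`: the reflected cup. -/
def cap (s : Bool) : P.Hom s 2 0 := P.adj (P.cup s)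

/-- Horizontal juxtaposition, with the numbers of strings added up automatically. -/
def ten {s t : Bool} {m n m' n' M N : ℕ} (f : P.Hom s m n) (g : P.Hom t m' n')
    (ht : t = sh s m) (hM : M = m + m' := by omega) (hN : N = n + n' := by omega) : P.Hom s M N :=
  P.beside ht hM hN f g

/-- `n` nested cups in a region of shading `s`. -/
def cups : ∀ (s : Bool) (n : ℕ), P.Hom s 0 (n + n)
  | s, 0 => P.strings s 0
  | s, n + 1 =>
    P.stack (P.cup s)
      (P.ten (m := 1) (n := 1 + (n + n)) (M := 2) (N := n + 1 + (n + 1))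
        (P.ten (M := 1) (P.strings s 1) (cups (!s) n) (shade_one s))
        (P.strings (!s) 1) (shade_one s))

/-- `n` nested caps in a region of shading `s`. -/
def caps (s : Bool) (n : ℕ) : P.Hom s (n + n) 0 := P.adj (P.cups s n)

/-- The counterclockwise rotation by 180 degrees: the bottom strings of `f` are bent up along the
right of `f`, its top strings are bent down along the left of `f`. -/
def rotLeft {s t : Bool} {m n : ℕ} (ht : t = sh s m) (hs : s = sh t n) (f : P.Hom s m n) :
    P.Hom t n m :=
  P.stack (P.stack
    (P.ten (M := n) (N := n + m + m) (P.strings t n) (P.cups s m) hs)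
    (P.ten (M := n + m + m) (N := n + n + m)
      (P.ten (M := n + m) (N := n + n) (P.strings t n) f hs) (P.strings t m)
      (by rw [sh_add, ← hs, ← ht])))
    (P.ten (M := n + n + m) (N := m) (P.caps t n) (P.strings t m) (shade_double t n))

/-- The clockwise rotation by 180 degrees: the bottom strings of `f` are bent up along the left of
`f`, its top strings are bent down along the right of `f`. -/
def rotRight {s t : Bool} {m n : ℕ} (ht : t = sh s m) (_hs : s = sh t n) (f : P.Hom s m n) :
    P.Hom t n m :=
  P.stack (P.stack
    (P.ten (M := n) (N := m + m + n) (P.cups t m) (P.strings t n) (sh_zero t).symm)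
    (P.ten (M := m + m + n) (N := m + n + n)
      (P.ten (M := m + m) (N := m + n) (P.strings t m) f (by rw [ht, sh_sh])) (P.strings t n)
      (shade_double t m)))
    (P.ten (M := m + n + n) (N := m) (P.strings t m) (P.caps s n) (by rw [ht, sh_sh]))

/-- The diagram obtained from an `n`-box by joining its top strings to its bottom strings around
the right of the box. -/
def closeUp {s : Bool} {n : ℕ} (f : P.Hom s n n) : P.Hom s 0 0 :=
  P.stack (P.stack (P.cups s n)
    (P.ten (M := n + n) (N := n + n) f (P.strings (sh s n) n) rfl)) (P.caps s n)

end PlanarOperations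

/-- A shaded planar `*`-algebra: the value of a diagram only depends on its isotopy class.

Isotopies of rectangular diagrams are generated by the rules below: stacking and juxtaposition are
associative and unital, boxes on different strings slide past each other (`stack_beside`), bent
strings can be pulled straight (`zigzag`), and rotating a box by 180 degrees in either direction
gives the same result, so that a full turn is trivial (`rotate`). In other words, this is a strict
pivotal 2-category with two objects whose 1-morphisms are the alternating words in one generating
1-morphism and its dual, with a compatible involution. -/
structure PlanarStarAlgebra extends PlanarOperations.{u} where
  /-- the shading of the rightmost region must be the same at the bottom and at the top -/
  parity : ∀ s m n, Odd (m + n) → Subsingleton (Hom s m n)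
  strings_stack : ∀ {s m n} (f : Hom s m n), stack (strings s m) f = f
  stack_strings : ∀ {s m n} (f : Hom s m n), stack f (strings s n) = f
  stack_assoc : ∀ {s m n k l} (f : Hom s m n) (g : Hom s n k) (h : Hom s k l),
    stack (stack f g) h = stack f (stack g h)
  strings_beside : ∀ {s m n} (f : Hom s m n) (ht : s = sh s 0) (hM : m = 0 + m) (hN : n = 0 + n),
    beside ht hM hN (strings s 0) f = f
  beside_strings : ∀ {s t m n} (f : Hom s m n) (ht : t = sh s m) (hM : m = m + 0)
    (hN : n = n + 0), beside ht hM hN f (strings t 0) = f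
  strings_beside_strings : ∀ {s t m m' M} (ht : t = sh s m) (hM : M = m + m'),
    beside ht hM hM (strings s m) (strings t m') = strings s M
  beside_assoc : ∀ {s t t' m n m' n' m'' n'' M N M' N' K L}
    (f : Hom s m n) (g : Hom t m' n') (h : Hom t' m'' n'')
    (h₁ : t = sh s m) (h₂ : M = m + m') (h₃ : N = n + n')
    (h₄ : t' = sh s M) (h₅ : K = M + m'') (h₆ : L = N + n'')
    (h₇ : t' = sh t m') (h₈ : M' = m' + m'') (h₉ : N' = n' + n'')
    (h₁₀ : K = m + M') (h₁₁ : L = n + N'),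
    beside h₄ h₅ h₆ (beside h₁ h₂ h₃ f g) h = beside h₁ h₁₀ h₁₁ f (beside h₇ h₈ h₉ g h)
  stack_beside : ∀ {s t m n k m' n' k' M N K}
    (f : Hom s m n) (g : Hom s n k) (f' : Hom t m' n') (g' : Hom t n' k')
    (ht : t = sh s m) (ht' : t = sh s n) (hM : M = m + m') (hN : N = n + n') (hK : K = k + k'),
    beside ht hM hK (stack f g) (stack f' g')
      = stack (beside ht hM hN f f') (beside ht' hN hK g g')
  adj_adj : ∀ {s m n} (f : Hom s m n), adj (adj f) = f
  adj_stack : ∀ {s m n k} (f : Hom s m n) (g : Hom s n k), adj (stack f g) = stack (adj g) (adj f)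
  adj_beside : ∀ {s t m n m' n' M N} (f : Hom s m n) (g : Hom t m' n')
    (ht : t = sh s m) (ht' : t = sh s n) (hM : M = m + m') (hN : N = n + n'),
    adj (beside ht hM hN f g) = beside ht' hN hM (adj f) (adj g)
  zigzag : ∀ s,
    stack (toPlanarOperations.ten (M := 1) (N := 3) (strings s 1) (cup (!s)) (shade_one s))
      (toPlanarOperations.ten (M := 3) (N := 1) (toPlanarOperations.cap s) (strings s 1)
        (shade_two s))
      = strings s 1
  rotate : ∀ {s t m n} (ht : t = sh s m) (hs : s = sh t n) (f : Hom s m n),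
    toPlanarOperations.rotLeft ht hs f = toPlanarOperations.rotRight ht hs f

/-- A `C*`-planar algebra: a shaded planar `*`-algebra in which every space of `n`-boxes is a
finite-dimensional `C*`-algebra (its norm is `boxNorm`) with a faithful positive trace, the trace
of an `n`-box being the value of a linear functional on `0`-boxes at the closed-up box. -/
structure CStarPlanarAlgebra extends PlanarStarAlgebra.{u} where
  finiteDimensional : ∀ s n, FiniteDimensional ℂ (Hom s n n)
  /-- the `C*`-norm on `n`-boxes -/
  boxNorm : ∀ {s n}, Hom s n n → ℝ
  boxNorm_add_le : ∀ {s n} (f g : Hom s n n), boxNorm (f + g) ≤ boxNorm f + boxNorm g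
  boxNorm_smul : ∀ {s n} (c : ℂ) (f : Hom s n n), boxNorm (c • f) = ‖c‖ * boxNorm f
  eq_zero_of_boxNorm : ∀ {s n} (f : Hom s n n), boxNorm f = 0 → f = 0
  boxNorm_stack_le : ∀ {s n} (f g : Hom s n n), boxNorm (stack f g) ≤ boxNorm f * boxNorm g
  boxNorm_adj_stack : ∀ {s n} (f : Hom s n n),
    boxNorm (stack (adj f) f) = boxNorm f * boxNorm f
  /-- the functionals on `0`-boxes that define the traces -/
  trace : ∀ s, Hom s 0 0 →ₗ[ℂ] ℂ
  trace_pos : ∀ {s n} (f : Hom s n n), f ≠ 0 →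
    ∃ c : ℝ, 0 < c ∧ trace s (toPlanarOperations.closeUp (stack f (adj f))) = c

namespace CStarPlanarAlgebra

variable (P : CStarPlanarAlgebra.{u})

/-- The space of `n`-boxes whose leftmost region has shading `s`. -/
abbrev Box (s : Bool) (n : ℕ) : Type u := P.Hom s n n

variable {P} {s t : Bool} {n : ℕ}

/-- The product `x * y` has `x` at the bottom and `y` at the top. -/
instance : Ring (P.Box s n) :=
  { (inferInstance : AddCommGroup (P.Box s n)) with
    mul := fun f g => P.stack f g
    one := P.strings s n
    left_distrib := fun f g h => map_add (P.stack f) g h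
    right_distrib := fun f g h => LinearMap.map_add₂ P.stack f g h
    zero_mul := fun f => LinearMap.map_zero₂ P.stack f
    mul_zero := fun f => map_zero (P.stack f)
    mul_assoc := fun f g h => P.stack_assoc f g h
    one_mul := fun f => P.strings_stack f
    mul_one := fun f => P.stack_strings f }

instance : Algebra ℂ (P.Box s n) :=
  Algebra.ofModule (fun c f g => LinearMap.map_smul₂ P.stack c f g)
    (fun c f g => map_smul (P.stack f) c g)

instance : StarRing (P.Box s n) where
  star := fun f => P.adj f
  star_involutive := fun f => P.adj_adj f
  star_mul := fun f g => P.adj_stack f g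
  star_add := fun f g => map_add P.adj f g

instance : StarModule ℂ (P.Box s n) where
  star_smul := fun c f => LinearMap.map_smulₛₗ P.adj c f

theorem boxNorm_neg (f : P.Hom s n n) : P.boxNorm (-f) = P.boxNorm f := by
  rw [← neg_one_smul ℂ f, P.boxNorm_smul]; simp

theorem boxNorm_zero : P.boxNorm (0 : P.Hom s n n) = 0 := by
  rw [← zero_smul ℂ (0 : P.Hom s n n), P.boxNorm_smul]; simp

noncomputable instance : NormedAddCommGroup (P.Box s n) :=
  AddGroupNorm.toNormedAddCommGroup
    { toFun := P.boxNorm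
      map_zero' := boxNorm_zero
      add_le' := P.boxNorm_add_le
      neg' := boxNorm_neg
      eq_zero_of_map_eq_zero' := P.eq_zero_of_boxNorm }

noncomputable instance : NormedRing (P.Box s n) :=
  { (inferInstance : NormedAddCommGroup (P.Box s n)), (inferInstance : Ring (P.Box s n)) with
    norm_mul_le := fun f g => P.boxNorm_stack_le f g }

noncomputable instance : NormedAlgebra ℂ (P.Box s n) where
  norm_smul_le := fun c f => (P.boxNorm_smul c f).le

instance : FiniteDimensional ℂ (P.Box s n) := P.finiteDimensional s n

instance : CompleteSpace (P.Box s n) := FiniteDimensional.complete ℂ _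

instance : CStarRing (P.Box s n) where
  norm_mul_self_le := fun f => (P.boxNorm_adj_stack f).ge

noncomputable instance : CStarAlgebra (P.Box s n) where

/-- A positive element. -/
def IsPos (a : P.Box s n) : Prop := ∃ b : P.Box s n, a = b * star b

/-- `e` is the range projection of `a`: the least projection with `e * a = a`. -/
def IsRangeProj (a e : P.Box s n) : Prop :=
  IsStarProjection e ∧ e * a = a ∧ ∀ f : P.Box s n, IsStarProjection f → f * a = a → e * f = e

/-- The rotation of a `1`-box by 180 degrees. -/
def bar (y : P.Box s 1) : P.Box (!s) 1 := P.rotLeft (shade_one s) (shade_one_not s) y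

/-- The rotation of a `1`-box by 180 degrees, as a map in the opposite direction. -/
def unbar (y : P.Box (!s) 1) : P.Box s 1 := P.rotLeft (shade_one_not s) (shade_one s) y

/-- The juxtaposition of two `1`-boxes. -/
def pair (y : P.Box s 1) (z : P.Box (!s) 1) : P.Box s 2 := P.ten y z (shade_one s)

/-- The Fourier transform: the clockwise rotation of a `2`-box by 90 degrees. The bottom strings
of the result are the bottom right and top right strings of `x`, its top strings are the bottom
left and top left strings of `x`. -/
def fourier (x : P.Box s 2) : P.Box (!s) 2 :=
  P.stack (P.stack
    (P.ten (M := 2) (N := 4) (P.cup (!s)) (P.strings (!s) 2) (sh_zero (!s)).symm)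
    (P.ten (M := 4) (N := 4) (P.ten (M := 3) (N := 3) (P.strings (!s) 1) x (shade_one_not s))
      (P.strings s 1) (shade_three_not s)))
    (P.ten (M := 4) (N := 2) (P.strings (!s) 2) (P.cap (!s)) (shade_two_not s))

/-- The convolution `y ∗ z` of a `1`-box with a `2`-box on its right: the string of `y` is joined
to the left string of `z` at the top and at the bottom. -/
def convLeft (y : P.Box s 1) (z : P.Box (!s) 2) : P.Box s 1 :=
  P.stack (P.stack
    (P.ten (M := 1) (N := 3) (P.cup s) (P.strings s 1) (sh_zero s).symm)
    (P.ten (M := 3) (N := 3) y z (shade_one s)))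
    (P.ten (M := 3) (N := 1) (P.cap s) (P.strings s 1) (shade_two s))

/-- The convolution `z ∗ w` of a `2`-box with a `1`-box on its right: the right string of `z` is
joined to the string of `w` at the top and at the bottom. -/
def convRight (z : P.Box s 2) (w : P.Box s 1) : P.Box s 1 :=
  P.stack (P.stack
    (P.ten (M := 1) (N := 3) (P.strings s 1) (P.cup (!s)) (shade_one s))
    (P.ten (M := 3) (N := 3) z w (shade_two s)))
    (P.ten (M := 3) (N := 1) (P.strings s 1) (P.cap (!s)) (shade_one s))

/-- `x` is `𝔉`-positive: its Fourier transform is positive. -/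
def IsFPositive (x : P.Box s 2) : Prop := IsPos (fourier x)

/-- The spectral radius of a `2`-box, in the algebra of `2`-boxes. -/
noncomputable def specRadius (x : P.Box s 2) : ℝ := (spectralRadius ℂ x).toReal

/-- The Perron-Frobenius eigenspace of `x`. -/
def eigenspace (x : P.Box s 2) : Set (P.Box s 1) :=
  {y | convLeft y (fourier x) = (specRadius x : ℂ) • y}

/-- The positive elements of a set. -/
def positivePart (S : Set (P.Box s n)) : Set (P.Box s n) := {y | y ∈ S ∧ IsPos y}

/-- `p` is the largest range projection of a positive element of the Perron-Frobenius eigenspace. -/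
def IsMaxSupport (x : P.Box s 2) (p : P.Box s 1) : Prop :=
  (∃ y ∈ positivePart (eigenspace x), IsRangeProj y p) ∧
    ∀ y ∈ positivePart (eigenspace x), ∀ q, IsRangeProj y q → q * p = q

/-- `ζ` is the maximally supported Perron-Frobenius eigenvector
`lim_{z → r⁺} (z - r) ∑_j (p ∗ 𝔉(x)^{∗j}) / z^{j+1}`, where `r` is the spectral radius of `x`. -/
def IsMaxEigenvector (x : P.Box s 2) (p ζ : P.Box s 1) : Prop :=
  ∃ S : ℝ → P.Box s 1,
    (∀ z : ℝ, specRadius x < z →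
      HasSum (fun j : ℕ => ((z : ℂ) ^ (j + 1))⁻¹ • (fun y => convLeft y (fourier x))^[j] p)
        (S z)) ∧
    Tendsto (fun z : ℝ => ((z - specRadius x : ℝ) : ℂ) • S z) (𝓝[>] (specRadius x)) (𝓝 ζ)

/-- `w` is a right Perron-Frobenius eigenvector of `x`. -/
def IsRightEigenvector (x : P.Box s 2) (w : P.Box (!s) 1) : Prop :=
  w ≠ 0 ∧ IsPos w ∧ convRight (fourier x) w = (specRadius x : ℂ) • w

/-- The element `(p ⊗ p̄) x (p ⊗ p̄)`. -/
def cutDown (x : P.Box s 2) (p : P.Box s 1) : P.Box s 2 :=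
  pair p (bar p) * x * pair p (bar p)

/-- The exchange algebra `𝒜` of `x`: the `1`-boxes `y` such that `ȳ`, placed on the right string,
can be moved through `x`. -/
def exchangeA (x : P.Box s 2) : Set (P.Box s 1) :=
  {y | x * pair 1 (bar y) = pair 1 (bar y) * x}

/-- The exchange algebra `ℬ` of `x`: the `1`-boxes `y` that, placed on the left string, can be moved
through `x`. -/
def exchangeB (x : P.Box s 2) : Set (P.Box s 1) :=
  {y | x * pair y 1 = pair y 1 * x}

/-- Two projections have infimum `0`: their only common subprojection is `0`. -/
def MeetZero (p q : P.Box s n) : Prop :=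
  ∀ e : P.Box s n, IsStarProjection e → e * p = e → e * q = e → e = 0

end CStarPlanarAlgebra

/-! Write the Fourier transform as `X = a a*`. A 1-box `v` acts on the 2-boxes containing `X` in two
commuting ways: `right v` puts `v` on the right string, and `left v` puts the rotation of `v` on the
left string. Let `E` close up the left string. Then convolution is `T y = E (left y * X)`. Closing
`E (z z*)` with the trace gives the 2-box trace of the rotated `z` times its adjoint, so `E` is
positive and faithful. Since `left` reverses products and `E` is tracial for it, `T (b b*) = E
((left b * a) (left b * a)*)`, and `T` is a positive map.

Perron–Frobenius part: finite dimension gives a positive eigenvector `y₀` whose support `p` contains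
the supports of all others. It is an order unit of the corner of `p`, so `T` preserves this corner
and its powers grow at most like `r ^ j` there. The Abel means of such a map converge to the
projection onto the eigenspace. Applied to `p` they give `ζ`, which dominates a multiple of `y₀` and
is therefore invertible in the corner, with inverse `η`.

Exchange part: after Fourier transform, `v ∈ 𝒜_p` says that `right v` and `left v` agree on the
cut-down kernel. Then `T (v ζ) = v T ζ`, which gives eigenvectors. Conversely, for a positive
eigenvector `y` put `v = y η`, so `y = v ζ`, factor `ζ = h* h`, and let `M = left h* (right v - left
v) a`. Of the four terms of `E (M M*)`, three equal `r v y` up to sign, so `E (M M*) = T (v y) - r v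
y`. The rotated right eigenvector gives a positive functional that `T` scales by `r`; it kills this
positive element, and the meet hypothesis makes it faithful on the corner. Hence `M = 0`, and
undoing `left h*` with `left η` yields the exchange relation. The statement for `ℬ_p` follows by
taking adjoints. -/

namespace PlanarStarAlgebra

/-! ### Whiskering and the interchange law -/

theorem eq_of_eq {α : Type*} {a b : α} (h : a = b) : a = b := h

variable {P : PlanarStarAlgebra.{u}}

/-- The shading counts strings modulo 2, and `parity` kills boxes with an odd total number of
strings. This dichotomy lets the calculus below dispense with parity hypotheses: a box whose two
sides disagree is zero and the identities are trivial. -/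
theorem sh_eq_or_eq_zero {s : Bool} {m n : ℕ} (f : P.Hom s m n) : sh s m = sh s n ∨ f = 0 := by
  by_cases h : Odd (m + n)
  · have := P.parity s m n h
    exact Or.inr (Subsingleton.elim _ _)
  · left
    have key : ∀ k, sh s k = xor s (decide (Odd k)) := by
      intro k
      induction k with
      | zero => simp
      | succ k ih =>
        simp only [sh, ih, Nat.odd_add_one]
        by_cases hk : Odd k <;> simp [hk]
    rw [key, key]
    congr 1
    simp only [decide_eq_decide]
    grind

/-- The box `f` with `a` through strings on its left and `b` through strings on its right. -/
def wh {s t : Bool} {m n M N : ℕ} (a : ℕ) (f : P.Hom t m n) (b : ℕ)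
    (h : t = sh s a := by
      exact eq_of_eq (by first | rfl | assumption | (subst_vars; simp [sh])))
    (hM : M = a + m + b := by exact eq_of_eq rfl)
    (hN : N = a + n + b := by exact eq_of_eq rfl) : P.Hom s M N :=
  P.beside (t := sh t m) (by rw [h, sh_add]) hM hN
    (P.beside h rfl rfl (P.strings s a) f) (P.strings (sh t m) b)

/-- Vertical stacking along `n` strings. -/
def comp {s : Bool} {m k : ℕ} (n : ℕ) (f : P.Hom s m n) (g : P.Hom s n k) : P.Hom s m k :=
  P.stack f g

local notation f:61 " ≫[" n "] " g:60 => comp n f g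

variable {s t t' : Bool} {m n k m' n' k' M N K L M' N' a b a' b' a'' b'' c A B : ℕ}

theorem wh_eq (f : P.Hom t m n) (h : t = sh s a) (hM : M = a + m + b)
    (hN : N = a + n + b) (hA : A = a + m) (hB : B = a + n) (ht' : t' = sh s A)
    (hM' : M = A + b) (hN' : N = B + b) :
    wh a f b h hM hN = P.beside ht' hM' hN' (P.beside h hA hB (P.strings s a) f)
      (P.strings t' b) := by
  subst hA hB
  obtain rfl : t' = sh t m := by rw [ht', h, sh_add]
  rfl

theorem wh_zero_left (f : P.Hom s m n) (h : s = sh s 0) (hM : M = 0 + m + b) (hN : N = 0 + n + b)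
    (ht : t = sh s m) (hM' : M = m + b) (hN' : N = n + b) :
    wh 0 f b h hM hN = P.beside ht hM' hN' f (P.strings t b) := by
  rw [wh_eq f h hM hN (Nat.zero_add m).symm (Nat.zero_add n).symm ht hM' hN', P.strings_beside]

theorem wh_zero_right (f : P.Hom t m n) (h : t = sh s a) (hM : M = a + m + 0) (hN : N = a + n + 0)
    (hM' : M = a + m) (hN' : N = a + n) :
    wh a f 0 h hM hN = P.beside h hM' hN' (P.strings s a) f := by
  subst hM' hN'
  rw [wh_eq f h hM hN rfl rfl rfl rfl rfl, P.beside_strings]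

theorem wh_zero_zero (f : P.Hom s m n) (h : s = sh s 0) (hM : m = 0 + m + 0) (hN : n = 0 + n + 0) :
    wh 0 f 0 h hM hN = f := by
  rw [wh_zero_left f h hM hN rfl rfl rfl, P.beside_strings]

theorem wh_strings (h : t = sh s a) (hM hN) :
    wh (M := M) (N := M) a (P.strings t m) b h hM hN = P.strings s M := by
  rw [wh_eq _ h hM hN rfl rfl rfl hM hN, P.strings_beside_strings, P.strings_beside_strings]

theorem wh_zero (h : t = sh s a) (hM : M = a + m + b) (hN : N = a + n + b) :
    wh a (0 : P.Hom t m n) b h hM hN = 0 := by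
  simp [wh]

/-- Splitting off the leftmost `a` strings exhibits a box far to the right as the second factor of a
juxtaposition, the form in which `stack_beside` applies. -/
theorem wh_eq_strings_beside (g : P.Hom t' m' n') (h : t' = sh s a') (hM : M = a' + m' + b')
    (hN : N = a' + n' + b') (ht : t = sh s a) (ha : a' = a + c) (hg : t' = sh t c)
    (hM' : M' = c + m' + b') (hN' : N' = c + n' + b') (h₁ : M = a + M') (h₂ : N = a + N') :
    wh a' g b' h hM hN = P.beside ht h₁ h₂ (P.strings s a) (wh c g b' hg hM' hN') := by
  have hs : sh s (a + (c + m')) = sh t (c + m') := by simp [ht]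
  rw [wh_eq g hg hM' hN' rfl rfl rfl hM' hN',
    ← P.beside_assoc (t := t) (h₂ := rfl) (h₃ := rfl) (h₄ := hs.symm) (h₅ := by omega)
      (h₆ := by omega),
    ← P.beside_assoc (h₂ := ha) (h₃ := ha) (h₄ := h) (h₅ := by omega) (h₆ := by omega),
    P.strings_beside_strings,
    wh_eq g h hM hN (A := a + (c + m')) (B := a + (c + n')) (by omega) (by omega) hs.symm
      (by omega) (by omega)]

theorem wh_wh (f : P.Hom t' m n) (h' : t' = sh t a') (hM' : M' = a' + m + b')
    (hN' : N' = a' + n + b') (h : t = sh s a) (hM : M = a + M' + b) (hN : N = a + N' + b)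
    (ha : a'' = a + a') (hb : b'' = b' + b) (h'' : t' = sh s a'') (hM'' : M = a'' + m + b'')
    (hN'' : N = a'' + n + b'') :
    wh a (wh a' f b' h' hM' hN') b h hM hN = wh a'' f b'' h'' hM'' hN'' := by
  rw [wh_eq _ h hM hN rfl rfl rfl hM hN, ← wh_eq_strings_beside f (a' := a'') (b' := b')
    (h := h'') (hM := by omega) (hN := by omega) (ha := ha)]
  rw [wh_eq f (A := a'' + m) (B := a'' + n) (h := h'') (t' := sh s (a'' + m)) (hA := rfl)
    (hB := rfl) (ht' := rfl) (hM' := by omega) (hN' := by omega),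
    wh_eq f (A := a'' + m) (B := a'' + n) (h := h'') (t' := sh s (a'' + m)) (hA := rfl)
    (hB := rfl) (ht' := rfl) (hM' := by omega) (hN' := by omega)]
  rw [P.beside_assoc (h₇ := by simp [hM', ← h, ← h', ha]) (h₈ := hb) (h₉ := hb)
    (h₁₀ := by omega) (h₁₁ := by omega), P.strings_beside_strings]

theorem comp_assoc (f : P.Hom s m n) (g : P.Hom s n k) (h : P.Hom s k K) :
    (f ≫[n] g) ≫[k] h = f ≫[n] g ≫[k] h :=
  P.stack_assoc f g h

theorem strings_comp (f : P.Hom s m n) : P.strings s m ≫[m] f = f := P.strings_stack f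

theorem comp_strings (f : P.Hom s m n) : f ≫[n] P.strings s n = f := P.stack_strings f

theorem zero_comp (f : P.Hom s n k) : (0 : P.Hom s m n) ≫[n] f = 0 := by simp [comp]

theorem comp_zero (f : P.Hom s m n) : f ≫[n] (0 : P.Hom s n k) = 0 := by simp [comp]

theorem beside_comp (f : P.Hom s m n) (g : P.Hom s n k) (f' : P.Hom t m' n') (g' : P.Hom t n' k')
    (ht : t = sh s m) (ht' : t = sh s n) (hM : M = m + m') (hN : N = n + n') (hK : K = k + k') :
    P.beside ht hM hK (f ≫[n] g) (f' ≫[n'] g')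
      = P.beside ht hM hN f f' ≫[N] P.beside ht' hN hK g g' :=
  P.stack_beside f g f' g' ht ht' hM hN hK

theorem adj_comp (f : P.Hom s m n) (g : P.Hom s n k) :
    P.adj (f ≫[n] g) = P.adj g ≫[n] P.adj f :=
  P.adj_stack f g

theorem wh_comp (f : P.Hom t m n) (g : P.Hom t n k) (h : t = sh s a) (hM : M = a + m + b)
    (hN : N = a + n + b) (hK : K = a + k + b) :
    wh a (f ≫[n] g) b h hM hK = wh a f b h hM hN ≫[N] wh a g b h hN hK := by
  rcases sh_eq_or_eq_zero f with hf | rfl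
  · rw [wh_eq f h hM hN rfl rfl rfl hM hN, wh_eq g h hN hK rfl rfl (t' := sh s (a + m))
      (by simp [← h, hf]) hN hK, ← beside_comp, strings_comp, ← beside_comp,
      strings_comp, wh_eq _ h hM hK rfl rfl rfl hM hK]
  · simp [wh_zero, zero_comp]

/-- Boxes on different strings slide past each other. -/
theorem exch (c : ℕ) (f : P.Hom t m n) (g : P.Hom t' m' n') (h₁ : t = sh s a) (h₂ : t' = sh s a')
    (h₃ : t' = sh s a'') (hM : M = a + m + b) (hN : N = a + n + b) (hN' : N = a' + m' + b')
    (hK : K = a' + n' + b') (hM' : M = a'' + m' + b') (hL : L = a'' + n' + b')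
    (hL' : L = a + m + b'') (hK' : K = a + n + b'')
    (ha' : a' = a + n + c) (ha'' : a'' = a + m + c) :
    wh a f b h₁ hM hN ≫[N] wh a' g b' h₂ hN' hK
      = wh a'' g b' h₃ hM' hL ≫[L] wh a f b'' h₁ hL' hK' := by
  rcases sh_eq_or_eq_zero f with hf | rfl
  · have e : sh s (a + m) = sh s (a + n) := by simp [← h₁, hf]
    have hb : b = c + m' + b' := by omega
    have hb' : b'' = c + n' + b' := by omega
    have hg : t' = sh (sh s (a + m)) c := by rw [h₃, ha'', sh_add]
    rw [wh_eq f h₁ hM hN rfl rfl rfl hM hN,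
      wh_eq_strings_beside g h₂ hN' hK e ha' hg hb hb' hN hK',
      ← beside_comp, comp_strings, strings_comp,
      wh_eq f h₁ hL' hK' rfl rfl rfl hL' hK',
      wh_eq_strings_beside g h₃ hM' hL rfl ha'' hg hb hb' hM hL',
      ← beside_comp, comp_strings, strings_comp]
  · simp [wh_zero, zero_comp, comp_zero]

theorem beside_eq (f : P.Hom s m n) (g : P.Hom t m' n') (ht : t = sh s m) (hM : M = m + m')
    (hN : N = n + n') (h : s = sh s 0) (ht' : t = sh s n) (h₁ : M = 0 + m + m')
    (h₂ : K = 0 + n + m') (h₃ : K = n + m' + 0) (h₄ : N = n + n' + 0) :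
    P.beside ht hM hN f g = wh 0 f m' h h₁ h₂ ≫[K] wh n g 0 ht' h₃ h₄ := by
  rw [wh_zero_left f h h₁ h₂ ht hM h₃, wh_zero_right g ht' h₃ h₄ h₃ h₄, ← beside_comp,
    comp_strings, strings_comp]

theorem adj_strings : P.adj (P.strings s n) = P.strings s n := by
  have h := P.adj_stack (P.adj (P.strings s n)) (P.strings s n)
  rw [P.stack_strings, P.adj_adj, P.stack_strings] at h
  exact h.symm

theorem adj_wh (f : P.Hom t m n) (h : t = sh s a) (hM : M = a + m + b) (hN : N = a + n + b) :
    P.adj (wh a f b h hM hN) = wh a (P.adj f) b h hN hM := by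
  rcases sh_eq_or_eq_zero f with hf | rfl
  · have e : sh s (a + m) = sh s (a + n) := by simp [← h, hf]
    rw [wh_eq f h hM hN rfl rfl rfl hM hN, P.adj_beside _ _ _ e, P.adj_beside _ _ _ h,
      adj_strings, adj_strings, wh_eq (P.adj f) h hN hM rfl rfl e hN hM]
  · simp [wh_zero]

theorem exch_assoc (c : ℕ) (f : P.Hom t m n) (g : P.Hom t' m' n') (h₁ : t = sh s a)
    (h₂ : t' = sh s a') (h₃ : t' = sh s a'') (hM : M = a + m + b) (hN : N = a + n + b)
    (hN' : N = a' + m' + b') (hK : K = a' + n' + b') (hM' : M = a'' + m' + b')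
    (hL : L = a'' + n' + b') (hL' : L = a + m + b'') (hK' : K = a + n + b'')
    (ha' : a' = a + n + c) (ha'' : a'' = a + m + c) (j : P.Hom s K k) :
    wh a f b h₁ hM hN ≫[N] wh a' g b' h₂ hN' hK ≫[K] j
      = wh a'' g b' h₃ hM' hL ≫[L] wh a f b'' h₁ hL' hK' ≫[K] j := by
  rw [← comp_assoc, exch c f g h₁ h₂ h₃ hM hN hN' hK hM' hL hL' hK' ha' ha'', comp_assoc]

/-! ### Cups, caps and the rotation of 1-boxes -/

theorem cups_one (s : Bool) : P.cups s 1 = P.cup s := by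
  simp only [PlanarOperations.cups, PlanarOperations.ten]
  rw [P.beside_strings]
  erw [P.strings_beside_strings, P.stack_strings]

theorem caps_one (s : Bool) : P.caps s 1 = P.cap s := congrArg P.adj (cups_one s)

theorem adj_cup (s : Bool) : P.adj (P.cup s) = P.cap s := rfl

theorem adj_cap (s : Bool) : P.adj (P.cap s) = P.cup s := P.adj_adj _

theorem cup_comp_cap_right (h : t = !s) :
    wh 1 (P.cup t) 0 ≫[3] wh 0 (P.cap s) 1 = P.strings s 1 := by
  subst h
  rw [wh_zero_right, wh_zero_left]
  exact P.zigzag s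

theorem cup_comp_cap_left (h : t = !s) :
    wh 0 (P.cup s) 1 ≫[3] wh 1 (P.cap t) 0 = P.strings s 1 := by
  have := congrArg P.adj (cup_comp_cap_right (P := P) h)
  rw [adj_comp, adj_wh, adj_wh, adj_strings, PlanarOperations.cap, P.adj_adj] at this
  exact this

/-- Pulling a bent string straight: the cup is on the left. -/
theorem zigzag_left (h₁ : t = sh s a) (h₂ : t' = sh s a') (hM : M = a + 0 + b)
    (hN : N = a + 2 + b) (hN' : N = a' + 2 + b') (hM' : M = a' + 0 + b') (ha : a' = a + 1) :
    wh a (P.cup t) b h₁ hM hN ≫[N] wh a' (P.cap t') b' h₂ hN' hM' = P.strings s M := by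
  have ht : t' = !t := by rw [h₁, h₂, ha]; rfl
  rw [← wh_strings (P := P) (m := 1) (b := b') h₁ (by omega) (by omega), ← cup_comp_cap_left ht,
    wh_comp (N := N) (hN := by omega), wh_wh (hM'' := hM) (hN'' := hN) (ha := (Nat.add_zero a).symm)
    (hb := by omega) (h'' := h₁), wh_wh (ha := ha) (hb := by omega)
    (hM'' := hN') (hN'' := hM') (h'' := h₂)]

/-- Pulling a bent string straight: the cup is on the right. -/
theorem zigzag_right (h₁ : t = sh s a) (h₂ : t' = sh s a') (hM : M = a + 0 + b)
    (hN : N = a + 2 + b) (hN' : N = a' + 2 + b') (hM' : M = a' + 0 + b') (ha : a = a' + 1) :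
    wh a (P.cup t) b h₁ hM hN ≫[N] wh a' (P.cap t') b' h₂ hN' hM' = P.strings s M := by
  have ht : t = !t' := by rw [h₁, h₂, ha]; rfl
  rw [← wh_strings (P := P) (m := 1) (b := b) h₂ (by omega) (by omega), ← cup_comp_cap_right ht,
    wh_comp (N := N) (hN := by omega), wh_wh (hM'' := hM) (hN'' := hN) (ha := ha)
    (hb := by omega) (h'' := h₁), wh_wh (ha := (Nat.add_zero a').symm) (hb := by omega)
    (hM'' := hN') (hN'' := hM') (h'' := h₂)]

theorem zigzag_right_assoc (h₁ : t = sh s a) (h₂ : t' = sh s a') (hM : M = a + 0 + b)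
    (hN : N = a + 2 + b) (hN' : N = a' + 2 + b') (hM' : M = a' + 0 + b') (ha : a = a' + 1)
    (j : P.Hom s M k) :
    wh a (P.cup t) b h₁ hM hN ≫[N] wh a' (P.cap t') b' h₂ hN' hM' ≫[M] j = j := by
  rw [← comp_assoc, zigzag_right (ha := ha), strings_comp]

theorem rotLeft_eq (h : t = !s) (h₁ : t = sh s 1) (h₂ : s = sh t 1) (y : P.Hom s 1 1) :
    P.rotLeft h₁ h₂ y = wh 1 (P.cup s) 0 ≫[3] wh 1 y 1 ≫[3] wh 0 (P.cap t) 1 := by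
  subst h
  rw [wh_zero_right, wh_zero_left, ← comp_assoc]
  · simp only [PlanarOperations.rotLeft, cups_one, caps_one, PlanarOperations.ten]
    rfl

theorem rotRight_eq (h : t = !s) (h₁ : t = sh s 1) (h₂ : s = sh t 1) (y : P.Hom s 1 1) :
    P.rotRight h₁ h₂ y = wh 0 (P.cup t) 1 ≫[3] wh 1 y 1 ≫[3] wh 1 (P.cap s) 0 := by
  subst h
  rw [wh_zero_right, wh_zero_left, ← comp_assoc]
  · simp only [PlanarOperations.rotRight, cups_one, caps_one, PlanarOperations.ten]
    rfl

/-- The rotation of a `1`-box by 180 degrees. -/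
def rot (h : t = !s) (y : P.Hom s 1 1) : P.Hom t 1 1 :=
  P.rotLeft h (by rw [h]; simp) y

theorem rot_eq_left (h : t = !s) (y : P.Hom s 1 1) :
    rot h y = wh 1 (P.cup s) 0 ≫[3] wh 1 y 1 ≫[3] wh 0 (P.cap t) 1 :=
  rotLeft_eq h _ _ y

theorem rot_eq_right (h : t = !s) (y : P.Hom s 1 1) :
    rot h y = wh 0 (P.cup t) 1 ≫[3] wh 1 y 1 ≫[3] wh 1 (P.cap s) 0 :=
  (P.rotate _ _ y).trans (rotRight_eq h _ _ y)

/-- Reflection interchanges the two ways of bending the strings, so this is where the equality of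
the two 180 degree rotations is needed. -/
theorem adj_rot (h : t = !s) (y : P.Hom s 1 1) : P.adj (rot h y) = rot h (P.adj y) := by
  rw [rot_eq_left, rot_eq_right, adj_comp, adj_comp, adj_wh, adj_wh, adj_wh, adj_cup, adj_cap,
    comp_assoc]

/-- With the string counts computed rather than free, this and `wh_wh'` serve as simp rules bringing
a diagram to a stack of layers with one box each; `exch` and the zigzag rules then act on such
stacks. -/
theorem wh_comp' (f : P.Hom t m n) (g : P.Hom t n k) (h : t = sh s a) (hM : M = a + m + b)
    (hK : K = a + k + b) :
    wh a (f ≫[n] g) b h hM hK = wh a f b h hM rfl ≫[a + n + b] wh a g b h rfl hK :=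
  wh_comp ..

theorem wh_wh' (f : P.Hom t' m n) (h' : t' = sh t a') (hM' : M' = a' + m + b')
    (hN' : N' = a' + n + b') (h : t = sh s a) (hM : M = a + M' + b) (hN : N = a + N' + b) :
    wh a (wh a' f b' h' hM' hN') b h hM hN = wh (a + a') f (b' + b) (by rw [h', h, sh_add])
      (by omega) (by omega) :=
  wh_wh (ha := rfl) (hb := rfl) ..

theorem eq_wh (f : P.Hom s m n) : f = wh 0 f 0 (sh_zero s).symm (by omega) (by omega) :=
  (wh_zero_zero f _ _ _).symm

/-- A 1-box travels along a bent string at the price of being rotated: two interchanges expose a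
zigzag, which is pulled straight. -/
theorem cup_rot (h : t = !s) (y : P.Hom s 1 1) :
    P.cup s ≫[2] wh 1 (rot h y) 0 = P.cup s ≫[2] wh 0 y 1 := by
  rw [rot_eq_left, eq_wh (P.cup s)]
  simp only [wh_comp', wh_wh', Nat.reduceAdd]
  calc wh 0 (P.cup s) 0 ≫[2] wh 2 (P.cup s) 0 ≫[4] wh 2 y 1 ≫[4] wh 1 (P.cap t) 1
    _ = wh 0 (P.cup s) 0 ≫[2] wh 0 (P.cup s) 2 ≫[4] wh 2 y 1 ≫[4] wh 1 (P.cap t) 1 := by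
      rw [exch_assoc 0 (P.cup s) (P.cup s)] <;> rfl
    _ = wh 0 (P.cup s) 0 ≫[2] wh 0 y 1 ≫[2] wh 0 (P.cup s) 2 ≫[4] wh 1 (P.cap t) 1 := by
      rw [exch_assoc 0 (P.cup s) y] <;> rfl
    _ = _ := by rw [zigzag_left (ha := rfl), comp_strings]

theorem rot_cap (h : t = !s) (y : P.Hom s 1 1) :
    wh 1 (rot h y) 0 ≫[2] P.cap s = wh 0 y 1 ≫[2] P.cap s := by
  have := congrArg P.adj (cup_rot h (P.adj y))
  rw [adj_comp, adj_comp, adj_wh, adj_wh, adj_rot, P.adj_adj, adj_cup] at this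
  exact this

theorem cup_rot_left (h : t = !s) (y : P.Hom s 1 1) :
    P.cup t ≫[2] wh 0 (rot h y) 1 = P.cup t ≫[2] wh 1 y 0 := by
  rw [rot_eq_right, eq_wh (P.cup t)]
  simp only [wh_comp', wh_wh', Nat.reduceAdd]
  calc wh 0 (P.cup t) 0 ≫[2] wh 0 (P.cup t) 2 ≫[4] wh 1 y 2 ≫[4] wh 1 (P.cap s) 1
    _ = wh 0 (P.cup t) 0 ≫[2] wh 2 (P.cup t) 0 ≫[4] wh 1 y 2 ≫[4] wh 1 (P.cap s) 1 := by
      symm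
      rw [exch_assoc 0 (P.cup t) (P.cup t)] <;> rfl
    _ = wh 0 (P.cup t) 0 ≫[2] wh 1 y 0 ≫[2] wh 2 (P.cup t) 0 ≫[4] wh 1 (P.cap s) 1 := by
      rw [exch_assoc 0 y (P.cup t)] <;> rfl
    _ = _ := by rw [zigzag_right (ha := rfl), comp_strings]

theorem rot_cap_left (h : t = !s) (y : P.Hom s 1 1) :
    wh 0 (rot h y) 1 ≫[2] P.cap t = wh 1 y 0 ≫[2] P.cap t := by
  have := congrArg P.adj (cup_rot_left h (P.adj y))
  rw [adj_comp, adj_comp, adj_wh, adj_wh, adj_rot, P.adj_adj, adj_cup] at this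
  exact this

/-- Bending a leg is undone by a cap, so a 1-box is determined by its composite with a cup. -/
theorem eq_bend (h : t = !s) (g : P.Hom t 1 1) :
    wh 1 (P.cup s ≫[2] wh 1 g 0) 0 ≫[3] wh 0 (P.cap t) 1 = g := by
  simp only [wh_comp', wh_wh', Nat.reduceAdd]
  rw [comp_assoc]
  calc wh 1 (P.cup s) 0 ≫[3] wh 2 g 0 ≫[3] wh 0 (P.cap t) 1
    _ = wh 1 (P.cup s) 0 ≫[3] wh 0 (P.cap t) 1 ≫[1] wh 0 g 0 := by
      rw [exch 0 (P.cap t) g] <;> rfl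
    _ = _ := by rw [zigzag_right_assoc (ha := rfl), wh_zero_zero]

theorem eq_of_cup_comp (h : t = !s) {g g' : P.Hom t 1 1}
    (e : P.cup s ≫[2] wh 1 g 0 = P.cup s ≫[2] wh 1 g' 0) : g = g' := by
  rw [← eq_bend h g, e, eq_bend h g']

theorem rot_comp (h : t = !s) (x y : P.Hom s 1 1) :
    rot h (x ≫[1] y) = rot h y ≫[1] rot h x := by
  apply eq_of_cup_comp h
  calc P.cup s ≫[2] wh 1 (rot h (x ≫[1] y)) 0
    _ = (P.cup s ≫[2] wh 0 x 1) ≫[2] wh 0 y 1 := by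
      rw [cup_rot, wh_comp (N := 2) (hN := rfl), comp_assoc]
    _ = P.cup s ≫[2] wh 1 (rot h x) 0 ≫[2] wh 0 y 1 := by rw [← cup_rot h, comp_assoc]
    _ = P.cup s ≫[2] wh 0 y 1 ≫[2] wh 1 (rot h x) 0 := by rw [exch 0 y (rot h x)] <;> rfl
    _ = (P.cup s ≫[2] wh 1 (rot h y) 0) ≫[2] wh 1 (rot h x) 0 := by rw [cup_rot, comp_assoc]
    _ = _ := by rw [wh_comp (N := 2) (hN := rfl), comp_assoc]

/-! ### Closed 1-boxes, closing the left string, and convolution -/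

theorem closeUp_eq (f : P.Hom s 1 1) :
    P.closeUp f = P.cup s ≫[2] wh 0 f 1 ≫[2] P.cap s := by
  rw [← comp_assoc]
  simp only [PlanarOperations.closeUp, PlanarOperations.ten]
  rw [cups_one, caps_one, wh_zero_left]
  · rfl

/-- Slide `x` over the cup onto the other leg, past `y`, and back over the cap. -/
theorem closeUp_comp_comm (x y : P.Hom s 1 1) : P.closeUp (x ≫[1] y) = P.closeUp (y ≫[1] x) := by
  have h : (!s) = !s := rfl
  rw [closeUp_eq, closeUp_eq]
  rw [wh_comp (N := 2) (hN := rfl), wh_comp (N := 2) (hN := rfl), comp_assoc, comp_assoc,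
    ← comp_assoc, ← cup_rot h, comp_assoc, ← rot_cap h x, ← comp_assoc (wh 1 (rot h x) 0),
    ← comp_assoc (wh 0 y 1)]
  congr 2
  symm
  rw [exch 0 y (rot h x)] <;> rfl

/-- The value of the diagram in which two neighbouring `1`-boxes are joined at the top and at the
bottom. -/
def pairing (h : t = !s) (y : P.Hom s 1 1) (w : P.Hom t 1 1) : P.Hom s 0 0 :=
  P.cup s ≫[2] wh 0 y 1 ≫[2] wh 1 w 0 ≫[2] P.cap s

theorem closeUp_comp_rot (h : t = !s) (h' : s = !t) (y : P.Hom s 1 1) (w : P.Hom t 1 1) :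
    P.closeUp (y ≫[1] rot h' w) = pairing h y w := by
  rw [closeUp_eq, wh_comp (N := 2) (hN := rfl), comp_assoc, rot_cap_left]
  rfl

/-- Joining the left strings of a `2`-box at the top and at the bottom. -/
def leftCap (h : t = !s) (z : P.Hom t 2 2) : P.Hom s 1 1 :=
  wh 0 (P.cup s) 1 ≫[3] wh 1 z 0 ≫[3] wh 0 (P.cap s) 1

/-- The convolution of a `1`-box with a `2`-box on its right. -/
def convL (h : t = !s) (y : P.Hom s 1 1) (z : P.Hom t 2 2) : P.Hom s 1 1 :=
  wh 0 (P.cup s) 1 ≫[3] wh 0 y 2 ≫[3] wh 1 z 0 ≫[3] wh 0 (P.cap s) 1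

/-- The convolution of a `2`-box with a `1`-box on its right. -/
def convR (h : s = !t) (z : P.Hom t 2 2) (w : P.Hom t 1 1) : P.Hom t 1 1 :=
  wh 1 (P.cup s) 0 ≫[3] wh 0 z 1 ≫[3] wh 2 w 0 ≫[3] wh 1 (P.cap s) 0

/-- The clockwise rotation of a `2`-box by 90 degrees. -/
def quarter (h : t = !s) (x : P.Hom s 2 2) : P.Hom t 2 2 :=
  wh 0 (P.cup t) 2 ≫[4] wh 1 x 1 ≫[4] wh 2 (P.cap t) 0

theorem convL_eq_leftCap (h : t = !s) (y : P.Hom s 1 1) (z : P.Hom t 2 2) :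
    convL h y z = leftCap h (wh 0 (rot h y) 1 ≫[2] z) := by
  have e := congrArg (fun f => wh (s := s) (M := 1) (N := 3) 0 f 1) (cup_rot h y)
  simp only [wh_comp', wh_wh', Nat.reduceAdd] at e
  simp only [convL, leftCap, wh_comp', wh_wh', Nat.reduceAdd]
  rw [comp_assoc, ← comp_assoc, ← e, comp_assoc]

/-- The box `w` lies on the closed left loop and can be carried around it from the bottom of `z` to
the top. -/
theorem leftCap_comm (h : t = !s) (w : P.Hom t 1 1) (z : P.Hom t 2 2) :
    leftCap h (wh 0 w 1 ≫[2] z) = leftCap h (z ≫[2] wh 0 w 1) := by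
  have h' : s = !t := by simp [h]
  have e := congrArg (fun f => wh (s := s) (M := 1) (N := 3) 0 f 1) (cup_rot_left h' w)
  have e' := congrArg (fun f => wh (s := s) (M := 3) (N := 1) 0 f 1) (rot_cap_left h' w)
  simp only [wh_comp', wh_wh', Nat.reduceAdd] at e e'
  simp only [leftCap, wh_comp', wh_wh', Nat.reduceAdd]
  rw [comp_assoc, comp_assoc, ← comp_assoc, ← e, ← e', comp_assoc]
  congr 1
  rw [exch_assoc 0 (rot h' w) z] <;> rfl

theorem leftCap_comp_left (h : t = !s) (v : P.Hom s 1 1) (z : P.Hom t 2 2) :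
    leftCap h (wh 1 v 0 ≫[2] z) = v ≫[1] leftCap h z := by
  simp only [leftCap, wh_comp', wh_wh', Nat.reduceAdd]
  nth_rw 2 [eq_wh v]
  rw [comp_assoc, exch_assoc 0 (P.cup s) v] <;> rfl

theorem leftCap_comp_right (h : t = !s) (v : P.Hom s 1 1) (z : P.Hom t 2 2) :
    leftCap h (z ≫[2] wh 1 v 0) = leftCap h z ≫[1] v := by
  simp only [leftCap, wh_comp', wh_wh', Nat.reduceAdd]
  nth_rw 2 [eq_wh v]
  rw [comp_assoc, comp_assoc, comp_assoc]
  congr 2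
  symm
  rw [exch 0 (P.cap s) v] <;> rfl

/-! ### The rotation of 2-boxes by 90 degrees -/

theorem quarter_inverse (h : t = !s) (x : P.Hom s 2 2) :
    wh 2 (P.cup s) 0 ≫[4] wh 1 (quarter h x) 1 ≫[4] wh 0 (P.cap s) 2 = x := by
  simp only [quarter, wh_comp', wh_wh', Nat.reduceAdd, comp_assoc]
  calc wh 2 (P.cup s) 0 ≫[4] wh 1 (P.cup t) 3 ≫[6] wh 2 x 2 ≫[6] wh 3 (P.cap t) 1
        ≫[4] wh 0 (P.cap s) 2
    _ = wh 1 (P.cup t) 1 ≫[4] wh 4 (P.cup s) 0 ≫[6] wh 2 x 2 ≫[6] wh 3 (P.cap t) 1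
        ≫[4] wh 0 (P.cap s) 2 := by
      rw [exch_assoc 1 (P.cup t) (P.cup s)] <;> rfl
    _ = wh 1 (P.cup t) 1 ≫[4] wh 2 x 0 ≫[4] wh 4 (P.cup s) 0 ≫[6] wh 3 (P.cap t) 1
        ≫[4] wh 0 (P.cap s) 2 := by
      rw [exch_assoc 0 x (P.cup s)] <;> rfl
    _ = wh 1 (P.cup t) 1 ≫[4] wh 0 (P.cap s) 2 ≫[2] wh 0 x 0 := by
      rw [zigzag_right_assoc (ha := rfl), exch 0 (P.cap s) x] <;> rfl
    _ = _ := by rw [zigzag_right_assoc (ha := rfl), wh_zero_zero]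

theorem quarter_injective (h : t = !s) : Function.Injective (quarter (P := P) h) :=
  fun x y e => by rw [← quarter_inverse h x, e, quarter_inverse]

/-- The quarter turn moves the bottom right, top right, bottom left and top left legs to the bottom
left, bottom right, top left and top right respectively. The four lemmas starting here follow a
1-box attached to each of these legs; it gets rotated exactly for the second and third. -/
theorem quarter_comp_right_bottom (h : t = !s) (w : P.Hom t 1 1) (x : P.Hom s 2 2) :
    quarter h (wh 1 w 0 ≫[2] x) = wh 0 w 1 ≫[2] quarter h x := by
  simp only [quarter, wh_comp', wh_wh', Nat.reduceAdd, comp_assoc]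
  rw [exch_assoc 0 (P.cup t) w] <;> rfl

theorem quarter_comp_right_top (h : t = !s) (v : P.Hom s 1 1) (x : P.Hom s 2 2) :
    quarter h (x ≫[2] wh 1 (rot h v) 0) = wh 1 v 0 ≫[2] quarter h x := by
  have e := congrArg (fun f => wh (s := t) (M := 4) (N := 2) 2 f 0) (rot_cap_left h v)
  simp only [wh_comp', wh_wh', Nat.reduceAdd] at e
  simp only [quarter, wh_comp', wh_wh', Nat.reduceAdd, comp_assoc]
  rw [e]
  calc wh 0 (P.cup t) 2 ≫[4] wh 1 x 1 ≫[4] wh 3 v 0 ≫[4] wh 2 (P.cap t) 0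
    _ = wh 0 (P.cup t) 2 ≫[4] wh 3 v 0 ≫[4] wh 1 x 1 ≫[4] wh 2 (P.cap t) 0 := by
      rw [exch_assoc 0 x v] <;> rfl
    _ = _ := by rw [exch_assoc 1 (P.cup t) v] <;> rfl

theorem quarter_comp_left_bottom (h : t = !s) (v : P.Hom s 1 1) (x : P.Hom s 2 2) :
    quarter h (wh 0 v 1 ≫[2] x) = quarter h x ≫[2] wh 0 (rot h v) 1 := by
  have e := congrArg (fun f => wh (s := t) (M := 2) (N := 4) 0 f 2) (cup_rot_left h v)
  simp only [wh_comp', wh_wh', Nat.reduceAdd] at e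
  simp only [quarter, wh_comp', wh_wh', Nat.reduceAdd, comp_assoc]
  rw [← comp_assoc, ← e, comp_assoc]
  congr 1
  calc wh 0 (rot h v) 3 ≫[4] wh 1 x 1 ≫[4] wh 2 (P.cap t) 0
    _ = wh 1 x 1 ≫[4] wh 0 (rot h v) 3 ≫[4] wh 2 (P.cap t) 0 := by
      rw [exch_assoc 0 (rot h v) x] <;> rfl
    _ = _ := by rw [exch 1 (rot h v) (P.cap t)] <;> rfl

theorem quarter_comp_left_top (h : t = !s) (v : P.Hom s 1 1) (x : P.Hom s 2 2) :
    quarter h (x ≫[2] wh 0 v 1) = quarter h x ≫[2] wh 1 v 0 := by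
  simp only [quarter, wh_comp', wh_wh', Nat.reduceAdd, comp_assoc]
  congr 2
  rw [exch 0 v (P.cap t)] <;> rfl

theorem cups_two (h : t = !s) : P.cups s 2 = P.cup s ≫[2] wh 1 (P.cup t) 1 := by
  subst h
  rw [wh_eq _ _ _ _ (A := 1) (B := 3) rfl rfl (shade_one s) rfl rfl]
  conv_lhs => rw [PlanarOperations.cups]
  rw [cups_one]
  rfl

/-- The closed diagram is a vector, namely the nested cups followed by `f`, composed with its own
reflection. -/
theorem closeUp_comp_adj (h : t = !s) (f : P.Hom s 2 2) :
    P.closeUp (f ≫[2] P.adj f) = (P.cup s ≫[2] wh 1 (P.cup t) 1 ≫[4] wh 0 f 2)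
      ≫[4] P.adj (P.cup s ≫[2] wh 1 (P.cup t) 1 ≫[4] wh 0 f 2) := by
  have e : P.closeUp (f ≫[2] P.adj f)
      = (P.cups s 2 ≫[4] wh 0 (f ≫[2] P.adj f) 2) ≫[4] P.caps s 2 := by
    simp only [PlanarOperations.closeUp, PlanarOperations.ten]
    rw [wh_zero_left]
    rfl
  rw [e, PlanarOperations.caps, cups_two h, wh_comp (N := 4) (hN := rfl), ← adj_wh,
    ← comp_assoc (P.cup s), adj_comp (P.cup s ≫[2] wh 1 (P.cup t) 1)]
  simp only [comp_assoc]

/-- Both sides are the "norm square" of the same vector, since `z` with all four legs bent up does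
not remember which legs were at the bottom. It transfers positivity and faithfulness of the 2-box
trace to `leftCap`. -/
theorem closeUp_leftCap_comp_adj (h : t = !s) (h' : s = !t) (z : P.Hom t 2 2) :
    P.closeUp (leftCap h (z ≫[2] P.adj z))
      = P.closeUp (quarter h' z ≫[2] P.adj (quarter h' z)) := by
  have e : P.cup s ≫[2] wh 1 (P.cup t) 1 ≫[4] wh 0 (quarter h' z) 2
      = P.cup s ≫[2] wh 0 (P.cup s) 2 ≫[4] wh 1 z 1 := by
    simp only [quarter, wh_comp', wh_wh', Nat.reduceAdd]
    congr 1
    calc wh 1 (P.cup t) 1 ≫[4] wh 0 (P.cup s) 4 ≫[6] wh 1 z 3 ≫[6] wh 2 (P.cap s) 2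
      _ = wh 0 (P.cup s) 2 ≫[4] wh 3 (P.cup t) 1 ≫[6] wh 1 z 3 ≫[6] wh 2 (P.cap s) 2 := by
        rw [exch_assoc 1 (P.cup s) (P.cup t)] <;> rfl
      _ = wh 0 (P.cup s) 2 ≫[4] wh 1 z 1 ≫[4] wh 3 (P.cup t) 1 ≫[6] wh 2 (P.cap s) 2 := by
        rw [exch_assoc 0 z (P.cup t)] <;> rfl
      _ = _ := by rw [zigzag_right (ha := rfl), comp_strings]
  rw [closeUp_comp_adj h, e, closeUp_eq, leftCap]
  simp only [adj_comp, adj_wh, adj_cup, wh_comp', wh_wh', Nat.reduceAdd, comp_assoc]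

/-- Both sides are the closed chain formed by `y`, `z` and `w`. It makes the two convolutions
adjoint to each other for the pairing. -/
theorem pairing_convL (h : t = !s) (h' : s = !t) (y : P.Hom s 1 1) (z : P.Hom t 2 2)
    (w : P.Hom t 1 1) : pairing h (convL h y z) w = pairing h y (convR h' z w) := by
  rw [pairing, pairing, convL, convR, eq_wh (P.cup s), eq_wh (P.cap s)]
  simp only [wh_comp', wh_wh', Nat.reduceAdd, comp_assoc]
  calc wh 0 (P.cup s) 0 ≫[2] wh 0 (P.cup s) 2 ≫[4] wh 0 y 3 ≫[4] wh 1 z 1 ≫[4] wh 0 (P.cap s) 2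
        ≫[2] wh 1 w 0 ≫[2] wh 0 (P.cap s) 0
    _ = wh 0 (P.cup s) 0 ≫[2] wh 0 (P.cup s) 2 ≫[4] wh 0 y 3 ≫[4] wh 1 z 1 ≫[4] wh 3 w 0
        ≫[4] wh 0 (P.cap s) 2 ≫[2] wh 0 (P.cap s) 0 := by
      rw [exch_assoc 1 (P.cap s) w] <;> rfl
    _ = wh 0 (P.cup s) 0 ≫[2] wh 0 (P.cup s) 2 ≫[4] wh 0 y 3 ≫[4] wh 1 z 1 ≫[4] wh 3 w 0
        ≫[4] wh 2 (P.cap s) 0 ≫[2] wh 0 (P.cap s) 0 := by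
      rw [exch 0 (P.cap s) (P.cap s)] <;> rfl
    _ = wh 0 (P.cup s) 0 ≫[2] wh 2 (P.cup s) 0 ≫[4] wh 0 y 3 ≫[4] wh 1 z 1 ≫[4] wh 3 w 0
        ≫[4] wh 2 (P.cap s) 0 ≫[2] wh 0 (P.cap s) 0 := by
      symm
      rw [exch_assoc 0 (P.cup s) (P.cup s)] <;> rfl
    _ = _ := by
      symm
      rw [exch_assoc 1 y (P.cup s)] <;> rfl

theorem wh_add (f g : P.Hom t m n) (h : t = sh s a) (hM : M = a + m + b) (hN : N = a + n + b) :
    wh a (f + g) b h hM hN = wh a f b h hM hN + wh a g b h hM hN := by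
  simp [wh]

theorem wh_smul (z : ℂ) (f : P.Hom t m n) (h : t = sh s a) (hM : M = a + m + b)
    (hN : N = a + n + b) : wh a (z • f) b h hM hN = z • wh a f b h hM hN := by
  simp [wh]

theorem rot_add (h : t = !s) (x y : P.Hom s 1 1) : rot h (x + y) = rot h x + rot h y := by
  simp [rot_eq_left, wh_add, comp]

theorem rot_smul (h : t = !s) (z : ℂ) (x : P.Hom s 1 1) : rot h (z • x) = z • rot h x := by
  simp [rot_eq_left, wh_smul, comp]

theorem leftCap_add (h : t = !s) (x y : P.Hom t 2 2) :
    leftCap h (x + y) = leftCap h x + leftCap h y := by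
  simp [leftCap, wh_add, comp]

theorem leftCap_smul (h : t = !s) (z : ℂ) (x : P.Hom t 2 2) :
    leftCap h (z • x) = z • leftCap h x := by
  simp [leftCap, wh_smul, comp]

end PlanarStarAlgebra

/-! ### Supports and corners in finite-dimensional C*-algebras -/

namespace FiniteDimensionalCStar

/-- The spectrum consists of roots of the minimal polynomial. Every function is therefore continuous
on it, and the functional calculus admits the discontinuous `t⁻¹`. -/
theorem finite_spectrum {A : Type*} [CStarAlgebra A] [FiniteDimensional ℂ A] (a : A) :
    (spectrum ℝ a).Finite := by
  have : FiniteDimensional ℝ A := FiniteDimensional.trans ℝ ℂ A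
  have hint : IsIntegral ℝ a := IsIntegral.of_finite ℝ a
  refine ((minpoly ℝ a).rootSet_finite ℝ).subset fun k hk => ?_
  have h := spectrum.subset_polynomial_aeval a (minpoly ℝ a) ⟨k, hk, rfl⟩
  rw [minpoly.aeval] at h
  rw [Polynomial.mem_rootSet]
  refine ⟨minpoly.ne_zero hint, ?_⟩
  have : Nontrivial A := by
    by_contra hA
    rw [not_nontrivial_iff_subsingleton] at hA
    simp [spectrum.of_subsingleton] at hk
  simpa using h

variable {A : Type*} [CStarAlgebra A] [PartialOrder A] [StarOrderedRing A]

/-- With the convention `0⁻¹ = 0`, `k = a⁻¹` is the pseudo-inverse and `e = a a⁻¹` the support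
projection. -/
theorem exists_support [FiniteDimensional ℂ A] {a : A} (ha : 0 ≤ a) :
    ∃ e k : A, ∃ c : ℝ, IsStarProjection e ∧ e * a = a ∧ a * e = a ∧ a * k = e ∧ k * a = e ∧
      e * k = k ∧ k * e = k ∧ e ≤ c • a := by
  have hs : IsSelfAdjoint a := .of_nonneg ha
  have hc (f : ℝ → ℝ) : ContinuousOn f (spectrum ℝ a) := (finite_spectrum a).continuousOn f
  have hmul (f g : ℝ → ℝ) : cfc f a * cfc g a = cfc (fun t => f t * g t) a :=
    (cfc_mul f g a (hc f) (hc g)).symm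
  have hid : cfc (fun t : ℝ => t) a = a := cfc_id' ℝ a
  have hma (f : ℝ → ℝ) : cfc f a * a = cfc (fun t => f t * t) a := by
    have := hmul f (fun t => t)
    rwa [hid] at this
  have ham (f : ℝ → ℝ) : a * cfc f a = cfc (fun t => t * f t) a := by
    have := hmul (fun t => t) f
    rwa [hid] at this
  have hk : 0 ≤ cfc (fun t : ℝ => t⁻¹) a :=
    cfc_nonneg fun t ht => inv_nonneg.mpr (spectrum_nonneg_of_nonneg ha ht)
  refine ⟨cfc (fun t : ℝ => t * t⁻¹) a, cfc (fun t : ℝ => t⁻¹) a,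
    ‖cfc (fun t : ℝ => t⁻¹) a‖, ⟨?_, cfc_predicate _ a⟩, ?_, ?_, ham _, ?_, ?_, ?_, ?_⟩
  · rw [IsIdempotentElem, hmul]
    congr 1; ext t; by_cases h : t = 0 <;> simp [h]
  · rw [hma]
    conv_rhs => rw [← hid]
    congr 1; ext t; by_cases h : t = 0 <;> simp [h]
  · rw [ham]
    conv_rhs => rw [← hid]
    congr 1; ext t; by_cases h : t = 0 <;> simp [h]
  · rw [hma]
    congr 1; ext t; ring
  · rw [hmul]
    congr 1; ext t; by_cases h : t = 0 <;> simp [h]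
  · rw [hmul]
    congr 1; ext t; by_cases h : t = 0 <;> simp [h]
  -- The product of the commuting positive elements `‖k‖ - k` and `a` is `‖k‖ a - e`.
  · have h₁ : 0 ≤ algebraMap ℝ A ‖cfc (fun t : ℝ => t⁻¹) a‖ - cfc (fun t : ℝ => t⁻¹) a :=
      sub_nonneg.mpr (IsSelfAdjoint.of_nonneg hk).le_algebraMap_norm_self
    have h₂ : Commute (algebraMap ℝ A ‖cfc (fun t : ℝ => t⁻¹) a‖ - cfc (fun t : ℝ => t⁻¹) a) a :=
      (Algebra.commute_algebraMap_left _ _).sub_left (by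
        rw [commute_iff_eq, hma, ham]; congr 1; ext t; ring)
    have h₃ := h₂.mul_nonneg h₁ ha
    rw [sub_mul, sub_nonneg, hma, ← Algebra.smul_def] at h₃
    convert h₃ using 3
    ring

theorem mul_eq_zero_of_conjugate {a c : A} (ha : 0 ≤ a) (h : star c * a * c = 0) : a * c = 0 := by
  obtain ⟨b, rfl⟩ := CStarAlgebra.nonneg_iff_eq_star_mul_self.mp ha
  have : b * c = 0 := by
    rw [← CStarRing.star_mul_self_eq_zero_iff, star_mul]
    simpa only [mul_assoc] using h
  rw [mul_assoc, this, mul_zero]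

/-- Conjugating `a ≤ b` by `c` squeezes `c* a c` between 0 and 0. -/
theorem mul_eq_zero_of_le {a b c : A} (ha : 0 ≤ a) (hab : a ≤ b) (h : b * c = 0) : a * c = 0 := by
  refine mul_eq_zero_of_conjugate ha (le_antisymm ?_ (star_left_conjugate_nonneg ha c))
  have := star_left_conjugate_le_conjugate hab c
  rwa [mul_assoc _ b, h, mul_zero] at this

theorem mul_eq_self_of_le {a b p : A} (ha : 0 ≤ a) (hab : a ≤ b) (h : b * p = b) : a * p = a := by
  have := mul_eq_zero_of_le (c := 1 - p) ha hab (by rw [mul_sub, mul_one, h, sub_self])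
  rw [mul_sub, mul_one, sub_eq_zero] at this
  exact this.symm

theorem mul_eq_self_comm {a p : A} (ha : 0 ≤ a) (hp : IsSelfAdjoint p) (h : a * p = a) :
    p * a = a := by
  have := congrArg star h
  rwa [star_mul, hp.star_eq, (IsSelfAdjoint.of_nonneg ha).star_eq] at this

theorem mul_eq_self_comm' {a p : A} (ha : 0 ≤ a) (hp : IsSelfAdjoint p) (h : p * a = a) :
    a * p = a := by
  have := congrArg star h
  rwa [star_mul, hp.star_eq, (IsSelfAdjoint.of_nonneg ha).star_eq] at this

theorem le_norm_smul {a p : A} (ha : IsSelfAdjoint a) (hp : IsStarProjection p) (h : a * p = a)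
    (h' : p * a = a) : a ≤ ‖a‖ • p := by
  have := star_left_conjugate_le_conjugate ha.le_algebraMap_norm_self p
  rwa [hp.isSelfAdjoint.star_eq, h', h, Algebra.algebraMap_eq_smul_one, mul_smul_comm, mul_one,
    smul_mul_assoc, hp.isIdempotentElem.eq] at this

/-- The corner is spanned by its positive elements: a self-adjoint `b` is the difference of `‖b‖ p`
and `‖b‖ p - b`, and a general element splits into real and imaginary parts. -/
theorem corner_induction {p : A} (hp : IsStarProjection p) (Q : Submodule ℂ A)
    (hQ : ∀ a, 0 ≤ a → p * a = a → a ∈ Q) {a : A} (h : p * a = a) (h' : a * p = a) : a ∈ Q := by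
  have hpp := hp.isIdempotentElem.eq
  have key : ∀ b : A, IsSelfAdjoint b → p * b = b → b * p = b → b ∈ Q := by
    intro b hb h h'
    have hpQ : ((‖b‖ : ℂ) • p) ∈ Q := Q.smul_mem _ (hQ p hp.nonneg hpp)
    have : ((‖b‖ : ℂ) • p - b) ∈ Q := by
      refine hQ _ ?_ (by rw [mul_sub, h, mul_smul_comm, hpp])
      rw [sub_nonneg]
      exact_mod_cast le_norm_smul hb hp h' h
    simpa using Q.sub_mem hpQ this
  have hs : p * star a = star a := by
    rw [← hp.isSelfAdjoint.star_eq, ← star_mul, h']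
  have hs' : star a * p = star a := by
    rw [← hp.isSelfAdjoint.star_eq, ← star_mul, h]
  have h₁ : a + star a ∈ Q :=
    key _ (by simp [IsSelfAdjoint, add_comm]) (by rw [mul_add, h, hs]) (by rw [add_mul, h', hs'])
  have h₂ : Complex.I • (a - star a) ∈ Q :=
    key _ (by rw [IsSelfAdjoint, star_smul, star_sub, star_star, ← neg_sub a, smul_neg]; simp)
      (by rw [mul_smul_comm, mul_sub, h, hs])
      (by rw [smul_mul_assoc, sub_mul, h', hs'])
  have h₃ := Q.smul_mem (1 / 2 : ℂ) (Q.sub_mem h₁ (Q.smul_mem Complex.I h₂))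
  convert h₃ using 1
  rw [smul_smul, Complex.I_mul_I]
  module

end FiniteDimensionalCStar

/-! ### Abel means of power bounded maps -/

namespace MeanErgodic

variable {V : Type*} [NormedAddCommGroup V] [NormedSpace ℂ V]
  {N : V →ₗ[ℂ] V} {r : ℝ}

/-- The Neumann series of the resolvent of `N` at `z`, applied to `a`. -/
noncomputable def resolventSeries (N : V →ₗ[ℂ] V) (z : ℝ) (a : V) : V :=
  ∑' j : ℕ, ((z : ℂ) ^ (j + 1))⁻¹ • (N ^ j) a

theorem norm_term_le (hr : 0 ≤ r) {a : V} {C : ℝ} (hC : ∀ j : ℕ, ‖(N ^ j) a‖ ≤ C * r ^ j) {z : ℝ}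
    (hz : r < z) (j : ℕ) :
    ‖((z : ℂ) ^ (j + 1))⁻¹ • (N ^ j) a‖ ≤ C / z * (r / z) ^ j := by
  have hz0 : 0 < z := hr.trans_lt hz
  rw [norm_smul, norm_inv, norm_pow, Complex.norm_real, Real.norm_of_nonneg hz0.le]
  calc (z ^ (j + 1))⁻¹ * ‖(N ^ j) a‖ ≤ (z ^ (j + 1))⁻¹ * (C * r ^ j) := by gcongr; exact hC j
    _ = C / z * (r / z) ^ j := by rw [div_pow]; field_simp; ring

theorem hasSum_geometric_bound (hr : 0 ≤ r) (C : ℝ) {z : ℝ} (hz : r < z) :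
    HasSum (fun j : ℕ => C / z * (r / z) ^ j) (C / (z - r)) := by
  have hz0 : 0 < z := hr.trans_lt hz
  have h := (hasSum_geometric_of_lt_one (div_nonneg hr hz0.le)
    ((div_lt_one hz0).mpr hz)).mul_left (C / z)
  have e : C / (z - r) = C / z * (1 - r / z)⁻¹ := by
    rw [one_sub_div hz0.ne', inv_div, div_mul_div_cancel₀ hz0.ne']
  rw [e]
  exact h

theorem norm_resolventSeries_le (hr : 0 ≤ r) {a : V} {C : ℝ}
    (hC : ∀ j : ℕ, ‖(N ^ j) a‖ ≤ C * r ^ j) {z : ℝ} (hz : r < z) :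
    ‖resolventSeries N z a‖ ≤ C / (z - r) :=
  tsum_of_norm_bounded (hasSum_geometric_bound hr C hz) (norm_term_le hr hC hz)

variable [FiniteDimensional ℂ V]

theorem hasSum_resolventSeries (hr : 0 ≤ r) {a : V} {C : ℝ}
    (hC : ∀ j : ℕ, ‖(N ^ j) a‖ ≤ C * r ^ j) {z : ℝ} (hz : r < z) :
    HasSum (fun j : ℕ => ((z : ℂ) ^ (j + 1))⁻¹ • (N ^ j) a) (resolventSeries N z a) :=
  have : CompleteSpace V := FiniteDimensional.complete ℂ V
  (Summable.of_norm_bounded (hasSum_geometric_bound hr C hz).summable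
    (norm_term_le hr hC hz)).hasSum

/-- On an eigenvector, dropping the first term of the series and multiplying by `z` has the same
effect as multiplying the series by `r`. -/
theorem resolventSeries_eigenvector (hr : 0 ≤ r) {a : V} {C : ℝ}
    (hC : ∀ j : ℕ, ‖(N ^ j) a‖ ≤ C * r ^ j) {z : ℝ} (hz : r < z) (ha : N a = (r : ℂ) • a) :
    ((z - r : ℝ) : ℂ) • resolventSeries N z a = a := by
  have hz0 : (z : ℂ) ≠ 0 := by exact_mod_cast (hr.trans_lt hz).ne'
  have h := hasSum_resolventSeries hr hC hz
  have h' := (((hasSum_nat_add_iff' 1).mpr h).const_smul (z : ℂ))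
  have h'' := h.const_smul (r : ℂ)
  have e : (fun j : ℕ => (z : ℂ) • ((z : ℂ) ^ (j + 1 + 1))⁻¹ • (N ^ (j + 1)) a)
      = fun j : ℕ => (r : ℂ) • ((z : ℂ) ^ (j + 1))⁻¹ • (N ^ j) a := by
    funext j
    rw [pow_succ N, Module.End.mul_apply, ha, map_smul, smul_smul, smul_smul, smul_smul]
    congr 1
    field_simp
    ring
  rw [e] at h'
  have := h'.unique h''
  simp only [Finset.range_one, Finset.sum_singleton, zero_add, pow_one, pow_zero,
    Module.End.one_apply, smul_sub, smul_smul, mul_inv_cancel₀ hz0, one_smul] at this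
  push_cast
  rw [sub_smul, ← this]
  abel

/-- The resolvent identity `R (N - r) = (z - r) R - 1`, obtained by shifting the series by one term.
-/
theorem resolventSeries_apply (hr : 0 ≤ r) {a : V} {C : ℝ}
    (hC : ∀ j : ℕ, ‖(N ^ j) a‖ ≤ C * r ^ j) {z : ℝ} (hz : r < z) :
    HasSum (fun j : ℕ => ((z : ℂ) ^ (j + 1))⁻¹ • (N ^ j) (N a - (r : ℂ) • a))
      (((z - r : ℝ) : ℂ) • resolventSeries N z a - a) := by
  have hz0 : (z : ℂ) ≠ 0 := by exact_mod_cast (hr.trans_lt hz).ne'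
  have h := hasSum_resolventSeries hr hC hz
  have h' := (((hasSum_nat_add_iff' 1).mpr h).const_smul (z : ℂ)).sub (h.const_smul (r : ℂ))
  convert h' using 1
  · funext j
    rw [map_sub, pow_succ N, Module.End.mul_apply, map_smul, smul_sub, smul_smul, smul_smul,
      smul_smul]
    congr 2
    · field_simp
      ring
    · ring
  · simp only [Finset.range_one, Finset.sum_singleton, zero_add, pow_one, pow_zero,
      Module.End.one_apply, smul_sub, smul_smul, mul_inv_cancel₀ hz0, one_smul]
    push_cast
    rw [sub_smul]
    abel

theorem tendsto_sub_right (r C : ℝ) :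
    Tendsto (fun z : ℝ => (z - r) * C) (𝓝[>] r) (𝓝 0) := by
  have : Tendsto (fun z : ℝ => (z - r) * C) (𝓝 r) (𝓝 ((r - r) * C)) :=
    (Continuous.tendsto (by fun_prop) r)
  rw [sub_self, zero_mul] at this
  exact this.mono_left nhdsWithin_le_nhds

/-- A power bounded multiple of a linear map has a semisimple leading eigenvalue, and the Abel
means converge to the eigenprojection. -/
theorem exists_tendsto_resolventSeries (hr : 0 ≤ r)
    (hb : ∀ a : V, ∃ C : ℝ, ∀ j : ℕ, ‖(N ^ j) a‖ ≤ C * r ^ j) (a : V) :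
    ∃ k : V, N k = (r : ℂ) • k ∧
      Tendsto (fun z : ℝ => ((z - r : ℝ) : ℂ) • resolventSeries N z a) (𝓝[>] r) (𝓝 k) := by
  set M : V →ₗ[ℂ] V := N - (r : ℂ) • LinearMap.id with hM
  have hMa (m : V) : M m = N m - (r : ℂ) • m := by simp [hM]
  -- By the resolvent identity the vector is `(z - r)` times the bounded quantity `(z - r) R m - m`.
  have hlim (m : V) :
      Tendsto (fun z : ℝ => ((z - r : ℝ) : ℂ) • resolventSeries N z (M m)) (𝓝[>] r) (𝓝 0) := by
    obtain ⟨C, hC⟩ := hb m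
    refine squeeze_zero_norm' ?_ (tendsto_sub_right r (C + ‖m‖))
    filter_upwards [self_mem_nhdsWithin] with z hz
    have hz : r < z := hz
    have hzr : 0 < z - r := sub_pos.mpr hz
    have e : resolventSeries N z (M m) = ((z - r : ℝ) : ℂ) • resolventSeries N z m - m := by
      rw [hMa]
      exact (resolventSeries_apply hr hC hz).tsum_eq
    rw [e, norm_smul, Complex.norm_real, Real.norm_of_nonneg hzr.le]
    gcongr
    refine (norm_sub_le _ _).trans ?_
    gcongr
    rw [norm_smul, Complex.norm_real, Real.norm_of_nonneg hzr.le]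
    calc (z - r) * ‖resolventSeries N z m‖ ≤ (z - r) * (C / (z - r)) := by
          gcongr; exact norm_resolventSeries_le hr hC hz
      _ = C := by field_simp
  have hker (k : V) (hk : N k = (r : ℂ) • k) :
      Tendsto (fun z : ℝ => ((z - r : ℝ) : ℂ) • resolventSeries N z k) (𝓝[>] r) (𝓝 k) := by
    obtain ⟨C, hC⟩ := hb k
    refine tendsto_const_nhds.congr' ?_
    filter_upwards [self_mem_nhdsWithin] with z hz
    exact (resolventSeries_eigenvector hr hC hz hk).symm
  -- On a common vector the Abel means tend both to the vector and to 0. Rank-nullity then makes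
  -- kernel and range span the whole space.
  have hdisj : Disjoint (LinearMap.ker M) (LinearMap.range M) := by
    rw [Submodule.disjoint_def]
    rintro u hu ⟨m, rfl⟩
    have hu' : N (M m) = (r : ℂ) • M m := by
      rwa [LinearMap.mem_ker, hMa, sub_eq_zero] at hu
    exact tendsto_nhds_unique (hker _ hu') (hlim m)
  have htop : LinearMap.ker M ⊔ LinearMap.range M = ⊤ := by
    apply Submodule.eq_top_of_disjoint _ _ _ hdisj
    rw [add_comm]
    exact (LinearMap.finrank_range_add_finrank_ker M).ge
  obtain ⟨k, hk, u, ⟨m, rfl⟩, rfl⟩ := Submodule.mem_sup.mp (htop ▸ Submodule.mem_top : a ∈ _)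
  have hk' : N k = (r : ℂ) • k := by
    rwa [LinearMap.mem_ker, hMa, sub_eq_zero] at hk
  refine ⟨k, hk', ?_⟩
  have h := (hker k hk').add (hlim m)
  rw [add_zero] at h
  refine h.congr' ?_
  filter_upwards [self_mem_nhdsWithin] with z hz
  obtain ⟨C, hC⟩ := hb k
  obtain ⟨C', hC'⟩ := hb (M m)
  have h₁ := (hasSum_resolventSeries hr hC hz).add (hasSum_resolventSeries hr hC' hz)
  rw [← smul_add, ← h₁.tsum_eq, resolventSeries]
  simp

end MeanErgodic

/-! ### Perron–Frobenius theory of a positive map -/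

namespace PositiveMap

open FiniteDimensionalCStar MeanErgodic

variable {A : Type*} [CStarAlgebra A] {T : A →ₗ[ℂ] A} {r : ℝ}

theorem map_real_smul (c : ℝ) (a : A) : T (c • a) = c • T a := by
  have := map_smul T (c : ℂ) a
  exact_mod_cast this

theorem pow_eigenvector {y₀ : A} (hy : T y₀ = (r : ℂ) • y₀) (j : ℕ) :
    (T ^ j) y₀ = (r : ℂ) ^ j • y₀ := by
  induction j with
  | zero => simp
  | succ j ih => rw [pow_succ, Module.End.mul_apply, hy, map_smul, ih, smul_smul, pow_succ']

variable [PartialOrder A]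

theorem pow_nonneg_map (hT : ∀ a, 0 ≤ a → 0 ≤ T a) (j : ℕ) {a : A} (ha : 0 ≤ a) :
    0 ≤ (T ^ j) a := by
  induction j generalizing a with
  | zero => simpa
  | succ j ih => rw [pow_succ, Module.End.mul_apply]; exact ih (hT a ha)

variable [StarOrderedRing A]

theorem mono (hT : ∀ a, 0 ≤ a → 0 ≤ T a) {a b : A} (h : a ≤ b) : T a ≤ T b := by
  rw [← sub_nonneg, ← map_sub]
  exact hT _ (sub_nonneg.mpr h)

/-- Take `y₀` with minimal right annihilator. Adding another positive eigenvector can only shrink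
the annihilator, so by minimality it does not change it. The value `y₀ = 0` is allowed. -/
theorem exists_dominating_eigenvector [FiniteDimensional ℂ A] (T : A →ₗ[ℂ] A) (r : ℝ) :
    ∃ y₀ : A, 0 ≤ y₀ ∧ T y₀ = (r : ℂ) • y₀ ∧
      ∀ y, 0 ≤ y → T y = (r : ℂ) • y → ∀ c, y₀ * c = 0 → y * c = 0 := by
  let S : Set A := {y | 0 ≤ y ∧ T y = (r : ℂ) • y}
  have hS : S.Nonempty := ⟨0, le_rfl, by simp⟩
  obtain ⟨y₀, hy₀, hmin⟩ := WellFounded.has_min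
    (InvImage.wf (fun y : A => LinearMap.ker (LinearMap.mulLeft ℂ y))
      (wellFounded_lt (α := Submodule ℂ A))) S hS
  refine ⟨y₀, hy₀.1, hy₀.2, fun y hy hyT c hc => ?_⟩
  have hle : LinearMap.ker (LinearMap.mulLeft ℂ (y₀ + y)) ≤
      LinearMap.ker (LinearMap.mulLeft ℂ y₀) := by
    intro c hc
    rw [LinearMap.mem_ker, LinearMap.mulLeft_apply] at hc ⊢
    exact mul_eq_zero_of_le hy₀.1 (le_add_of_nonneg_right hy) hc
  have hnot : ¬ LinearMap.ker (LinearMap.mulLeft ℂ (y₀ + y)) <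
      LinearMap.ker (LinearMap.mulLeft ℂ y₀) :=
    hmin (y₀ + y) ⟨add_nonneg hy₀.1 hy, by rw [map_add, hy₀.2, hyT, smul_add]⟩
  have heq := hle.eq_of_not_lt hnot
  have hc' : c ∈ LinearMap.ker (LinearMap.mulLeft ℂ (y₀ + y)) := by
    rw [heq, LinearMap.mem_ker, LinearMap.mulLeft_apply, hc]
  rw [LinearMap.mem_ker, LinearMap.mulLeft_apply, add_mul, hc, zero_add] at hc'
  exact hc'

/-- The elements of the corner of a projection. -/
def corner {A : Type*} [CStarAlgebra A] (p : A) : Submodule ℂ A where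
  carrier := {a | p * a = a ∧ a * p = a}
  add_mem' h h' := ⟨by rw [mul_add, h.1, h'.1], by rw [add_mul, h.2, h'.2]⟩
  zero_mem' := ⟨mul_zero p, zero_mul p⟩
  smul_mem' c _ h := ⟨by rw [mul_smul_comm, h.1], by rw [smul_mul_assoc, h.2]⟩

section Support

variable {p y₀ : A} {c : ℝ}

/-- The bound `p ≤ c y₀` makes `y₀` an order unit of the corner. Applying `T` or its powers to the
resulting bound gives invariance of the corner and the growth estimate. -/
theorem le_smul_of_corner (hp : IsStarProjection p) (hc : p ≤ c • y₀) {a : A} (ha : 0 ≤ a)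
    (hpa : p * a = a) : a ≤ (‖a‖ * c) • y₀ := by
  rw [mul_smul]
  exact (le_norm_smul (.of_nonneg ha) hp (mul_eq_self_comm' ha hp.isSelfAdjoint hpa) hpa).trans
    (smul_le_smul_of_nonneg_left hc (norm_nonneg a))

theorem map_mem_corner (hT : ∀ a, 0 ≤ a → 0 ≤ T a) (hp : IsStarProjection p)
    (hpy : y₀ * p = y₀) (hy : T y₀ = (r : ℂ) • y₀) (hc : p ≤ c • y₀) {a : A}
    (ha : a ∈ corner p) : T a ∈ corner p := by
  refine corner_induction hp ((corner p).comap T) (fun a ha hpa => ?_) ha.1 ha.2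
  have h : T a ≤ (‖a‖ * c) • (r : ℂ) • y₀ := by
    rw [← hy, ← map_real_smul]
    exact mono hT (le_smul_of_corner hp hc ha hpa)
  have h' := mul_eq_self_of_le (hT a ha) h (by rw [smul_mul_assoc, smul_mul_assoc, hpy])
  exact ⟨mul_eq_self_comm (hT a ha) hp.isSelfAdjoint h', h'⟩

theorem exists_norm_pow_le (hT : ∀ a, 0 ≤ a → 0 ≤ T a) (hr : 0 ≤ r) (hp : IsStarProjection p)
    (hy : T y₀ = (r : ℂ) • y₀) (hc : p ≤ c • y₀) {a : A}
    (ha : a ∈ corner p) : ∃ C : ℝ, ∀ j : ℕ, ‖(T ^ j) a‖ ≤ C * r ^ j := by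
  let Q : Submodule ℂ A :=
    { carrier := {a | ∃ C : ℝ, ∀ j : ℕ, ‖(T ^ j) a‖ ≤ C * r ^ j}
      add_mem' := by
        rintro a b ⟨C, hC⟩ ⟨C', hC'⟩
        refine ⟨C + C', fun j => ?_⟩
        rw [map_add, add_mul]
        exact (norm_add_le _ _).trans (add_le_add (hC j) (hC' j))
      zero_mem' := ⟨0, fun j => by simp⟩
      smul_mem' := by
        rintro c a ⟨C, hC⟩
        refine ⟨‖c‖ * C, fun j => ?_⟩
        rw [map_smul, norm_smul, mul_assoc]
        exact mul_le_mul_of_nonneg_left (hC j) (norm_nonneg c) }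
  refine corner_induction hp Q (fun a ha hpa => ?_) ha.1 ha.2
  refine ⟨‖(‖a‖ * c) • y₀‖, fun j => ?_⟩
  have h₁ : (T ^ j) a ≤ (r : ℂ) ^ j • ((‖a‖ * c) • y₀) := by
    rw [smul_comm, ← pow_eigenvector hy, ← map_real_smul]
    exact mono (fun a ha => pow_nonneg_map hT j ha) (le_smul_of_corner hp hc ha hpa)
  refine (CStarAlgebra.norm_le_norm_of_nonneg_of_le (pow_nonneg_map hT j ha) h₁).trans ?_
  rw [norm_smul, norm_pow, Complex.norm_real, Real.norm_of_nonneg hr, mul_comm]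

end Support

theorem exists_maximal_support [FiniteDimensional ℂ A] (hT : ∀ a, 0 ≤ a → 0 ≤ T a) (hr : 0 ≤ r) :
    ∃ p ζ η : A, IsStarProjection p ∧
      (∃ y₀ k, 0 ≤ y₀ ∧ T y₀ = (r : ℂ) • y₀ ∧ p * y₀ = y₀ ∧ y₀ * k = p) ∧
      (∀ y, 0 ≤ y → T y = (r : ℂ) • y → p * y = y) ∧ (∀ a ∈ corner p, T a ∈ corner p) ∧
      (∃ S : ℝ → A,
        (∀ z : ℝ, r < z → HasSum (fun j : ℕ => ((z : ℂ) ^ (j + 1))⁻¹ • (T ^ j) p) (S z)) ∧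
        Tendsto (fun z : ℝ => ((z - r : ℝ) : ℂ) • S z) (𝓝[>] r) (𝓝 ζ)) ∧
      0 ≤ ζ ∧ T ζ = (r : ℂ) • ζ ∧ ζ * η = p ∧ η * ζ = p ∧ ζ ∈ corner p ∧ η ∈ corner p := by
  obtain ⟨y₀, hy₀, hTy, hmax⟩ := exists_dominating_eigenvector T r
  obtain ⟨p, k, c, hp, hpy, hyp, hyk, -, -, -, hc⟩ := exists_support hy₀
  have hpp : p ∈ corner p := ⟨hp.isIdempotentElem, hp.isIdempotentElem⟩
  have hTW : ∀ a ∈ corner p, T a ∈ corner p := fun a => map_mem_corner hT hp hyp hTy hc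
  let N : corner p →ₗ[ℂ] corner p := T.restrict hTW
  have hN (j : ℕ) (a : corner p) : (((N ^ j) a : corner p) : A) = (T ^ j) (a : A) := by
    induction j generalizing a with
    | zero => simp
    | succ j ih => rw [pow_succ, pow_succ, Module.End.mul_apply, Module.End.mul_apply, ih]; rfl
  have hb (a : corner p) : ∃ C : ℝ, ∀ j : ℕ, ‖(N ^ j) a‖ ≤ C * r ^ j := by
    obtain ⟨C, hC⟩ := exists_norm_pow_le hT hr hp hTy hc a.2
    refine ⟨C, fun j => ?_⟩
    change ‖(((N ^ j) a : corner p) : A)‖ ≤ _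
    rw [hN]
    exact hC j
  have hsum (a : corner p) (z : ℝ) (hz : r < z) :
      HasSum (fun j : ℕ => ((z : ℂ) ^ (j + 1))⁻¹ • (T ^ j) (a : A))
        (resolventSeries N z a : corner p) := by
    obtain ⟨C, hC⟩ := hb a
    have := (hasSum_resolventSeries hr hC hz).mapL (corner p).subtypeL
    simpa [hN] using this
  obtain ⟨ζ, hζ, hlim⟩ := exists_tendsto_resolventSeries hr hb ⟨p, hpp⟩
  have hTζ : T (ζ : A) = (r : ℂ) • (ζ : A) := congrArg Subtype.val hζ
  have hlimA : Tendsto (fun z : ℝ => ((z - r : ℝ) : ℂ) •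
      ((resolventSeries N z ⟨p, hpp⟩ : corner p) : A)) (𝓝[>] r) (𝓝 (ζ : A)) :=
    (continuous_subtype_val.tendsto ζ).comp hlim
  -- Compare the Abel means of `y₀ ≤ ‖y₀‖ p` term by term: they fix the eigenvector `y₀` and send
  -- `p` to `ζ` in the limit.
  have hle : y₀ ≤ ‖y₀‖ • (ζ : A) := by
    refine ge_of_tendsto (hlimA.const_smul ‖y₀‖) ?_
    filter_upwards [self_mem_nhdsWithin] with z hz
    have hz : r < z := hz
    obtain ⟨C, hC⟩ := hb ⟨y₀, hpy, hyp⟩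
    have e := congrArg Subtype.val (resolventSeries_eigenvector hr hC hz (Subtype.ext hTy))
    have hz0 : 0 < z := hr.trans_lt hz
    have h := hasSum_le (fun j => ?_) (hsum ⟨y₀, hpy, hyp⟩ z hz)
      ((hsum ⟨p, hpp⟩ z hz).const_smul ‖y₀‖)
    · rw [smul_comm]
      change ((z - r : ℝ) : ℂ) • _ = y₀ at e
      conv_lhs => rw [← e]
      have := smul_le_smul_of_nonneg_left h (sub_pos.mpr hz).le
      exact_mod_cast this
    · have h₁ : (T ^ j) y₀ ≤ ‖y₀‖ • (T ^ j) p := by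
        rw [← map_real_smul]
        exact mono (fun a ha => pow_nonneg_map hT j ha) (le_norm_smul (.of_nonneg hy₀) hp hyp hpy)
      have := smul_le_smul_of_nonneg_left h₁ (inv_nonneg.mpr (pow_nonneg hz0.le (j + 1)))
      rw [smul_comm] at this
      exact_mod_cast this
  have hζ0 : 0 ≤ (ζ : A) := by
    refine ge_of_tendsto hlimA ?_
    filter_upwards [self_mem_nhdsWithin] with z hz
    have hz : r < z := hz
    have hz0 : 0 < z := hr.trans_lt hz
    have h : (0 : A) ≤ (resolventSeries N z ⟨p, hpp⟩ : corner p) := by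
      refine HasSum.nonneg (fun j => ?_) (hsum ⟨p, hpp⟩ z hz)
      have := smul_nonneg (inv_nonneg.mpr (pow_nonneg hz0.le (j + 1)))
        (pow_nonneg_map hT j hp.nonneg)
      exact_mod_cast this
    have := smul_nonneg (sub_pos.mpr hz).le h
    exact_mod_cast this
  obtain ⟨q, η, -, hq, hqζ, hζq, hζη, hηζ, hqη, hηq, -⟩ := exists_support hζ0
  -- The support `q` of `ζ` lies under `p` because `ζ` is in the corner; conversely `p ≤ c y₀` and
  -- `y₀ ≤ ‖y₀‖ ζ` put `p` under `q`.
  have hpq : p = q := by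
    have h₁ : q * p = q := by
      rw [← hηζ, mul_assoc, ζ.2.2]
    have h₂ : y₀ * q = y₀ := mul_eq_self_of_le hy₀ hle (by rw [smul_mul_assoc, hζq])
    have h₃ : p * q = p := mul_eq_self_of_le hp.nonneg hc (by rw [smul_mul_assoc, h₂])
    have h₄ := congrArg star h₁
    rw [star_mul, hp.isSelfAdjoint.star_eq, hq.isSelfAdjoint.star_eq] at h₄
    exact h₃.symm.trans h₄
  subst hpq
  refine ⟨p, ζ, η, hp, ⟨y₀, k, hy₀, hTy, hpy, hyk⟩, fun y hy hyT => ?_, hTW,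
    ⟨_, hsum ⟨p, hpp⟩, hlimA⟩, hζ0, hTζ, hζη, hηζ, ζ.2, hqη, hηq⟩
  have := hmax y hy hyT (1 - p) (by rw [mul_sub, mul_one, hyp, sub_self])
  rw [mul_sub, mul_one, sub_eq_zero] at this
  exact mul_eq_self_comm hy hp.isSelfAdjoint this.symm

end PositiveMap

/-! ### The exchange argument in abstract form -/

open FiniteDimensionalCStar PositiveMap

/-- A `*`-algebra `B` with commuting left and right actions of a `C*`-algebra `A` (the left one
reversing products), a positive faithful map `E : B → A` that is bilinear for the right action and
tracial for the left one, and a faithful trace on `A`. -/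
structure BimoduleExpectation (A B : Type*) [CStarAlgebra A] [PartialOrder A] [StarOrderedRing A]
    [Ring B] [StarRing B] [Algebra ℂ B] where
  left : A →ₗ[ℂ] B
  right : A →ₗ[ℂ] B
  E : B →ₗ[ℂ] A
  τ : A →ₗ[ℂ] ℂ
  left_mul : ∀ a b, left (a * b) = left b * left a
  left_star : ∀ a, left (star a) = star (left a)
  right_mul : ∀ a b, right (a * b) = right a * right b
  right_star : ∀ a, right (star a) = star (right a)
  left_right : ∀ a b, left a * right b = right b * left a
  E_right_mul : ∀ a z, E (right a * z) = a * E z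
  E_mul_right : ∀ a z, E (z * right a) = E z * a
  E_left_comm : ∀ a z, E (left a * z) = E (z * left a)
  E_nonneg : ∀ z, 0 ≤ E (z * star z)
  E_faithful : ∀ z, E (z * star z) = 0 → z = 0
  τ_comm : ∀ a b, τ (a * b) = τ (b * a)
  τ_faithful : ∀ a, τ (a * star a) = 0 → a = 0

namespace BimoduleExpectation

variable {A B : Type*} [CStarAlgebra A] [PartialOrder A] [StarOrderedRing A]
  [Ring B] [StarRing B] [Algebra ℂ B] (D : BimoduleExpectation A B)

/-- The map on `A` with kernel `X`. -/
noncomputable def transfer (X : B) : A →ₗ[ℂ] A where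
  toFun a := D.E (D.left a * X)
  map_add' a b := by rw [map_add, add_mul, map_add]
  map_smul' c a := by rw [map_smul, smul_mul_assoc, map_smul, RingHom.id_apply]

theorem transfer_apply (X : B) (a : A) : D.transfer X a = D.E (D.left a * X) := rfl

/-- The kernel cut down by a projection on both sides. -/
noncomputable def cut (p : A) (X : B) : B := D.right p * D.left p * X * (D.left p * D.right p)

/-- Traciality of `E` for the left action brings the last factor `left (star a)` to the front, and
the reversal of products recombines it into `left (a * star a)`. -/
theorem transfer_conj (x : B) (a : A) :
    D.E ((D.left a * x) * star (D.left a * x)) = D.transfer (x * star x) (a * star a) := by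
  rw [transfer_apply, D.left_mul, star_mul, mul_assoc, ← D.left_star, ← mul_assoc x,
    ← mul_assoc, ← D.E_left_comm]
  simp only [mul_assoc]

theorem transfer_nonneg (x : B) {a : A} (ha : 0 ≤ a) : 0 ≤ D.transfer (x * star x) a := by
  obtain ⟨b, rfl⟩ := CStarAlgebra.nonneg_iff_eq_mul_star_self.mp ha
  rw [← transfer_conj]
  exact D.E_nonneg _

theorem transfer_cut (p : A) (X : B) (a : A) :
    D.transfer (D.cut p X) a = p * D.transfer X (p * a * p) * p := by
  have h₁ : D.left a * (D.right p * D.left p * X * (D.left p * D.right p))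
      = D.right p * (D.left a * D.left p * X * D.left p) * D.right p := by
    rw [← D.left_right p p]
    simp only [← mul_assoc]
    rw [mul_assoc (D.left a), D.left_right p p, ← mul_assoc, D.left_right a p]
  rw [transfer_apply, cut, h₁, D.E_mul_right, D.E_right_mul, ← D.E_left_comm, transfer_apply,
    D.left_mul, D.left_mul]
  simp only [mul_assoc]

/-- The exchange relation turns the left action of `v` into the right action, for which `E` is a
module map. -/
theorem transfer_mul_of_exchange {X : B} {v : A} (h : D.right v * X = D.left v * X) (a : A) :
    D.transfer X (v * a) = v * D.transfer X a := by
  rw [transfer_apply, transfer_apply, D.left_mul, mul_assoc, ← h, ← mul_assoc, D.left_right,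
    mul_assoc, D.E_right_mul]

theorem star_cut (p : A) (hp : star p = p) (x : B) :
    star (D.cut p (x * star x)) = D.cut p (x * star x) := by
  simp only [cut, star_mul, star_star, ← D.left_star, ← D.right_star, hp, mul_assoc]

theorem exchange_star {X : B} (hX : star X = X) (v : A) :
    X * D.left v = X * D.right v ↔ D.right (star v) * X = D.left (star v) * X := by
  rw [← star_inj, star_mul, star_mul, hX, ← D.left_star, ← D.right_star, eq_comm]

/-- An exchange element acts on the eigenvectors in the corner. -/
theorem eigenvector_of_exchange {p ζ v : A} {r : ℝ} (hps : star p = p) {x : B}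
    (hζp : ζ ∈ corner p) (hTζ : D.transfer (x * star x) ζ = (r : ℂ) • ζ)
    (hcorner : ∀ a ∈ corner p, D.transfer (x * star x) a ∈ corner p)
    (hv : D.right v * D.cut p (x * star x) = D.left v * D.cut p (x * star x))
    (hs : star (v * ζ) = v * ζ) :
    D.transfer (x * star x) (v * ζ) = (r : ℂ) • (v * ζ) := by
  -- Cutting down the kernel compresses the map by `p`, which changes nothing on an invariant
  -- corner.
  have key : ∀ a ∈ corner p, D.transfer (D.cut p (x * star x)) a = D.transfer (x * star x) a := by
    intro a ha
    rw [D.transfer_cut, ha.1, ha.2, (hcorner a ha).1, (hcorner a ha).2]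
  have h₁ : v * ζ * p = v * ζ := by rw [mul_assoc, hζp.2]
  have h₂ : p * (v * ζ) = v * ζ := by
    -- Only right multiplication by `p` is controlled for a product ending in `ζ`; self-adjointness
    -- supplies the other side.
    have := congrArg star h₁
    rwa [star_mul, hs, hps] at this
  rw [← key _ ⟨h₂, h₁⟩, D.transfer_mul_of_exchange hv, key _ hζp, hTζ, mul_smul_comm]

/-- Every self-adjoint eigenvector in the corner is obtained from an invertible one by an exchange
element, if there is a faithful invariant functional on the corner. -/
theorem exchange_of_eigenvector [FiniteDimensional ℂ A] {p ζ η w y : A} {r : ℝ} {x : B}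
    (hζ : 0 ≤ ζ) (hTζ : D.transfer (x * star x) ζ = (r : ℂ) • ζ) (hζη : ζ * η = p)
    (hηζ : η * ζ = p) (hη : η ∈ corner p)
    (hcorner : ∀ a ∈ corner p, D.transfer (x * star x) a ∈ corner p) (hw : 0 ≤ w)
    (hinv : ∀ a, D.τ (D.transfer (x * star x) a * w) = r * D.τ (a * w))
    (hmeet : ∀ e : A, IsStarProjection e → e * p = e → e * w = 0 → e = 0)
    (hyp : y ∈ corner p) (hy : star y = y) (hTy : D.transfer (x * star x) y = (r : ℂ) • y) :
    D.right (y * η) * D.cut p (x * star x) = D.left (y * η) * D.cut p (x * star x) ∧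
      y = y * η * ζ := by
  have hζs : star ζ = ζ := (IsSelfAdjoint.of_nonneg hζ).star_eq
  have hyv : y = y * η * ζ := by rw [mul_assoc, hηζ, hyp.2]
  refine ⟨?_, hyv⟩
  set v := y * η with hv
  have hvp : v ∈ corner p := ⟨by rw [hv, ← mul_assoc, hyp.1], by rw [hv, mul_assoc, hη.2]⟩
  have hζv : ζ * star v = y := by
    rw [← hζs, ← star_mul, ← hyv, hy]
  obtain ⟨h, rfl⟩ := CStarAlgebra.nonneg_iff_eq_star_mul_self.mp hζ
  set T := D.transfer (x * star x) with hT
  -- `M` measures the failure of the exchange relation, weighted by the square root factor `h` of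
  -- `ζ`. The weight makes each term of `E (M M*)` a value of `T`, up to right multiplications.
  set M : B := D.left (star h) * ((D.right v - D.left v) * x) with hM
  have hEM : D.E (M * star M) = T (v * y) - (r : ℂ) • (v * y) := by
    have e₁ : star h * h * star v = y := hζv
    have e₂ : v * (star h * h) = y := hyv.symm
    have e₃ : y * star v = v * y := by rw [← e₁, ← mul_assoc, e₁, e₂]
    have hexp : M * star M = D.left (star h) * ((D.right v - D.left v) * (x * star x) *
        (D.right (star v) - D.left (star v))) * D.left h := by
      rw [hM]
      simp only [star_mul, star_sub, ← D.left_star, ← D.right_star, star_star, mul_assoc]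
    rw [hexp, ← D.E_left_comm, ← mul_assoc, ← D.left_mul]
    have t₁ : D.E (D.left (star h * h) * (D.right v * (x * star x) * D.right (star v)))
        = (r : ℂ) • (v * y) := by
      rw [mul_assoc, ← mul_assoc, D.left_right, mul_assoc, D.E_right_mul, ← mul_assoc (D.left _),
        D.E_mul_right, ← D.transfer_apply, ← hT, hTζ, smul_mul_assoc, e₁, mul_smul_comm]
    have t₂ : D.E (D.left (star h * h) * (D.right v * (x * star x) * D.left (star v)))
        = (r : ℂ) • (v * y) := by
      rw [mul_assoc, ← mul_assoc, D.left_right, mul_assoc, D.E_right_mul, ← mul_assoc (D.left _),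
        ← D.E_left_comm, ← mul_assoc, ← D.left_mul, e₁, ← D.transfer_apply, ← hT, hTy,
        mul_smul_comm]
    have t₃ : D.E (D.left (star h * h) * (D.left v * (x * star x) * D.right (star v)))
        = (r : ℂ) • (v * y) := by
      rw [← mul_assoc, D.E_mul_right, ← mul_assoc, ← D.left_mul, e₂, ← D.transfer_apply, ← hT,
        hTy, smul_mul_assoc, e₃]
    have t₄ : D.E (D.left (star h * h) * (D.left v * (x * star x) * D.left (star v)))
        = T (v * y) := by
      rw [← mul_assoc, ← D.E_left_comm, ← mul_assoc (D.left (star h * h)), ← D.left_mul, e₂,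
        ← mul_assoc, ← D.left_mul, e₃, hT, D.transfer_apply]
    simp only [sub_mul, mul_sub, map_sub, t₁, t₂, t₃, t₄]
    abel
  have hvy : v * y ∈ corner p :=
    ⟨by rw [← mul_assoc, hvp.1], by rw [mul_assoc, hyp.2]⟩
  have hEp : D.E (M * star M) ∈ corner p := by
    rw [hEM]
    exact (corner p).sub_mem (hcorner _ hvy) ((corner p).smul_mem _ hvy)
  have hτ : D.τ (D.E (M * star M) * w) = 0 := by
    rw [hEM, sub_mul, map_sub, hinv, smul_mul_assoc, map_smul, smul_eq_mul, sub_self]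
  have hE0 : 0 ≤ D.E (M * star M) := D.E_nonneg M
  -- For positive `d` and `w`, faithfulness of the trace turns `τ (d w) = 0` into `d w = 0`. The
  -- support of `d` is then a subprojection of `p` annihilating `w`, which must vanish.
  have hE : D.E (M * star M) = 0 := by
    generalize D.E (M * star M) = d at hEp hτ hE0
    have hdw : d * w = 0 := by
      obtain ⟨c, rfl⟩ := CStarAlgebra.nonneg_iff_eq_mul_star_self.mp hE0
      obtain ⟨u, rfl⟩ := CStarAlgebra.nonneg_iff_eq_mul_star_self.mp hw
      have h₁ : star u * c = 0 := by
        apply D.τ_faithful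
        rw [star_mul, star_star, ← hτ, mul_assoc, D.τ_comm]
        simp only [mul_assoc]
      have h₂ := congrArg star h₁
      rw [star_mul, star_star, star_zero] at h₂
      rw [mul_assoc, ← mul_assoc (star c), h₂, zero_mul, mul_zero]
    obtain ⟨e, k, -, he, hed, -, -, hkd, -⟩ := exists_support hE0
    have := hmeet e he (by rw [← hkd, mul_assoc, hEp.2]) (by rw [← hkd, mul_assoc, hdw, mul_zero])
    rw [← hed, this, zero_mul]
  have hM0 : M = 0 := D.E_faithful M hE
  -- The factor `left h*` is cancelled using `left p = left η * left h * left h*`.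
  have h₁ : D.left p * ((D.right v - D.left v) * x) = 0 := by
    rw [← hζη, D.left_mul, D.left_mul, mul_assoc, mul_assoc, ← hM, hM0, mul_zero, mul_zero]
  have h₂ : D.right v * D.right p = D.right p * D.right v := by
    rw [← D.right_mul, ← D.right_mul, hvp.1, hvp.2]
  have h₃ : D.left v * D.left p = D.left p * D.left v := by
    rw [← D.left_mul, ← D.left_mul, hvp.1, hvp.2]
  have h₄ : (D.right v - D.left v) * (D.right p * D.left p)
      = D.right p * D.left p * (D.right v - D.left v) := by
    have h₅ : D.right v * (D.right p * D.left p) = D.right p * D.left p * D.right v := by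
      rw [← mul_assoc, h₂, mul_assoc, mul_assoc, D.left_right]
    have h₆ : D.left v * (D.right p * D.left p) = D.right p * D.left p * D.left v := by
      rw [← mul_assoc, D.left_right, mul_assoc, h₃, mul_assoc]
    rw [sub_mul, mul_sub, h₅, h₆]
  rw [← sub_eq_zero, ← sub_mul, cut]
  calc (D.right v - D.left v) *
        (D.right p * D.left p * (x * star x) * (D.left p * D.right p))
    _ = ((D.right v - D.left v) * (D.right p * D.left p)) * x * star x *
        (D.left p * D.right p) := by simp only [mul_assoc]
    _ = D.right p * (D.left p * ((D.right v - D.left v) * x)) * star x *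
        (D.left p * D.right p) := by rw [h₄]; simp only [mul_assoc]
    _ = 0 := by rw [h₁]; simp

end BimoduleExpectation

/-! ### The planar algebra as a bimodule expectation -/

namespace CStarPlanarAlgebra

open PlanarStarAlgebra PositiveMap FiniteDimensionalCStar

local notation f:61 " ≫[" n "] " g:60 => comp n f g

variable {P : CStarPlanarAlgebra.{u}} {s t : Bool} {n : ℕ}

noncomputable instance : PartialOrder (P.Box s n) := CStarAlgebra.spectralOrder _

instance : StarOrderedRing (P.Box s n) := CStarAlgebra.spectralOrderedRing _

theorem isPos_iff (a : P.Box s n) : IsPos a ↔ 0 ≤ a :=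
  CStarAlgebra.nonneg_iff_eq_mul_star_self.symm

theorem convLeft_eq (y : P.Box s 1) (z : P.Box (!s) 2) : convLeft y z = convL rfl y z := by
  simp only [convLeft, PlanarOperations.ten]
  rw [beside_eq (K := 3) y z (shade_one s) rfl rfl rfl (shade_one s) rfl rfl rfl rfl, convL,
    wh_zero_left (P.cup s) rfl rfl rfl rfl rfl rfl,
    wh_zero_left (P.cap s) rfl rfl rfl (shade_two s) rfl rfl]
  exact P.stack_assoc _ _ _ |>.trans (congrArg _ (P.stack_assoc _ _ _))

theorem convRight_eq (h : s = !t) (z : P.Box t 2) (w : P.Box t 1) :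
    convRight z w = convR h z w := by
  subst h
  simp only [convRight, PlanarOperations.ten]
  rw [beside_eq (K := 3) z w (shade_two t) rfl rfl rfl (shade_two t) rfl rfl rfl rfl, convR,
    wh_zero_right (P.cup (!t)) (shade_one t) rfl rfl rfl rfl,
    wh_zero_right (P.cap (!t)) (shade_one t) rfl rfl rfl rfl]
  exact P.stack_assoc _ _ _ |>.trans (congrArg _ (P.stack_assoc _ _ _))

theorem fourier_eq (x : P.Box s 2) : fourier x = quarter rfl x := by
  simp only [fourier, PlanarOperations.ten]
  rw [quarter, wh_zero_left, wh_zero_right (P.cap (!s)), wh_eq (A := 3) (B := 3) x]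
  exact P.stack_assoc _ _ _

theorem pair_eq (y : P.Box s 1) (z : P.Box (!s) 1) :
    pair y z = wh 0 y 1 ≫[2] wh 1 z 0 :=
  beside_eq y z (shade_one s) rfl rfl rfl (shade_one s) rfl rfl rfl rfl

theorem pair_one_right (y : P.Box s 1) : pair y 1 = wh 0 y 1 :=
  (wh_zero_left y rfl rfl rfl (shade_one s) rfl rfl).symm

theorem pair_one_left (z : P.Box (!s) 1) : pair 1 z = wh 1 z 0 :=
  (wh_zero_right z (shade_one s) rfl rfl rfl rfl).symm

theorem trace_closeUp_ne_zero {f : P.Box s n} (hf : f ≠ 0) :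
    P.trace s (P.closeUp (f * star f)) ≠ 0 := by
  obtain ⟨c, hc, h⟩ := P.trace_pos f hf
  have h : P.trace s (P.closeUp (f * star f)) = c := h
  rw [h]
  exact_mod_cast hc.ne'

theorem closeUp_neg (f : P.Box s n) : P.closeUp (-f) = -P.closeUp f := by
  simp [PlanarOperations.closeUp, PlanarOperations.ten]

theorem closeUp_add (f g : P.Box s n) : P.closeUp (f + g) = P.closeUp f + P.closeUp g := by
  simp [PlanarOperations.closeUp, PlanarOperations.ten]

theorem closeUp_smul (c : ℂ) (f : P.Box s n) : P.closeUp (c • f) = c • P.closeUp f := by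
  simp [PlanarOperations.closeUp, PlanarOperations.ten]

theorem closeUp_zero : P.closeUp (0 : P.Hom s n n) = 0 := by
  simp [PlanarOperations.closeUp, PlanarOperations.ten]

theorem trace_closeUp_nonneg (f : P.Box s n) :
    ∃ c : ℝ, 0 ≤ c ∧ P.trace s (P.closeUp (f * star f)) = c := by
  by_cases hf : f = 0
  · refine ⟨0, le_rfl, ?_⟩
    rw [hf, zero_mul, closeUp_zero, map_zero, Complex.ofReal_zero]
  · obtain ⟨c, hc, h⟩ := P.trace_pos f hf
    exact ⟨c, hc.le, h⟩

theorem leftCap_star (z : P.Box (!s) 2) :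
    star (leftCap (s := s) rfl z) = leftCap rfl (star z) := by
  change P.adj _ = leftCap rfl (P.adj z)
  rw [leftCap, leftCap, adj_comp, adj_comp, adj_wh, adj_wh, adj_wh, adj_cup, adj_cap, comp_assoc]

theorem trace_closeUp_leftCap (z : P.Box (!s) 2) :
    P.trace s (P.closeUp (leftCap (s := s) rfl (z * star z)))
      = P.trace s (P.closeUp (quarter (Bool.not_not s).symm z
        * star (quarter (Bool.not_not s).symm z))) :=
  congrArg (P.trace s) (closeUp_leftCap_comp_adj rfl (Bool.not_not s).symm z)

/-- Let `k` be the closed-up element. By bimodularity the trace of `d k d*` is a 2-box trace of a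
positive element, hence nonnegative. For `d` the negative part `k⁻` it is minus the trace of the
cube of `k⁻`, so faithfulness forces `k⁻ = 0`. -/
theorem leftCap_mul_star_nonneg (z : P.Box (!s) 2) :
    0 ≤ leftCap (s := s) rfl (z * star z) := by
  set k : P.Box s 1 := leftCap (s := s) rfl (z * star z) with hk
  have hks : IsSelfAdjoint k := by
    rw [IsSelfAdjoint, hk, leftCap_star, star_mul, star_star]
  have hconj (d : P.Box s 1) : ∃ c : ℝ, 0 ≤ c ∧ P.trace s (P.closeUp (d * k * star d)) = c := by
    obtain ⟨c, hc, h⟩ := trace_closeUp_nonneg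
      (quarter (Bool.not_not s).symm ((wh 1 d 0 : P.Box (!s) 2) * z))
    refine ⟨c, hc, ?_⟩
    rw [← h, ← trace_closeUp_leftCap]
    have e₁ : d * k = leftCap rfl ((wh 1 d 0 : P.Box (!s) 2) * (z * star z)) :=
      (leftCap_comp_left rfl d _).symm
    have e₂ : star (wh 1 d 0 : P.Box (!s) 2) = wh 1 (star d) 0 := adj_wh _ _ _ _
    have e₃ : d * k * star d
        = leftCap rfl ((wh 1 d 0 : P.Box (!s) 2) * (z * star z) * wh 1 (star d) 0) := by
      rw [e₁]
      exact (leftCap_comp_right rfl (star d) _).symm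
    rw [e₃, star_mul, e₂]
    simp only [mul_assoc]
  have hneg : 0 ≤ k⁻ := CFC.negPart_nonneg k
  have hns : star k⁻ = k⁻ := (IsSelfAdjoint.of_nonneg hneg).star_eq
  have hcube : k⁻ * k * star k⁻ = -(k⁻ * k⁻ * star k⁻) := by
    have e : k⁻ * k = -(k⁻ * k⁻) := by
      have := congrArg (k⁻ * ·) (CFC.posPart_sub_negPart k hks)
      simpa only [mul_sub, CFC.negPart_mul_posPart, zero_sub] using this.symm
    rw [e, neg_mul]
  obtain ⟨b, hb⟩ := CStarAlgebra.nonneg_iff_eq_mul_star_self.mp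
    (star_right_conjugate_nonneg hneg k⁻)
  have hb0 : b = 0 := by
    by_contra hb0
    obtain ⟨c, hc, h⟩ := P.trace_pos b hb0
    obtain ⟨c', hc', h'⟩ := hconj k⁻
    have h : P.trace s (P.closeUp (b * star b)) = c := h
    rw [hcube, hb, closeUp_neg, map_neg, h] at h'
    have : -c = c' := by exact_mod_cast h'
    linarith
  rw [hb0, zero_mul] at hb
  have h₂ : k⁻ * k⁻ = 0 :=
    FiniteDimensionalCStar.mul_eq_zero_of_conjugate hneg (by rwa [hns] at hb ⊢)
  have h₃ : k⁻ = 0 := by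
    rw [← CStarRing.star_mul_self_eq_zero_iff, hns, h₂]
  rw [← CFC.posPart_sub_negPart k hks, h₃, sub_zero]
  exact CFC.posPart_nonneg k

theorem eq_zero_of_leftCap_eq_zero (z : P.Box (!s) 2)
    (h : leftCap (s := s) rfl (z * star z) = 0) : z = 0 := by
  by_contra hz
  have hq : quarter (Bool.not_not s).symm z ≠ 0 := by
    intro hq
    apply hz
    apply quarter_injective (Bool.not_not s).symm
    rw [hq]
    simp [quarter, wh_zero, comp_zero, zero_comp]
  apply trace_closeUp_ne_zero hq
  rw [← trace_closeUp_leftCap, h, closeUp_zero, map_zero]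

/-- The bimodule structure of the `2`-boxes over the `1`-boxes. -/
noncomputable def boxExpectation (P : CStarPlanarAlgebra.{u}) (s : Bool) :
    BimoduleExpectation (P.Box s 1) (P.Box (!s) 2) where
  left :=
    { toFun := fun a => wh 0 (rot rfl a) 1
      map_add' := fun a b =>
        (congrArg (fun f => wh 0 f 1) (rot_add rfl a b)).trans (wh_add _ _ _ _ _)
      map_smul' := fun c a =>
        (congrArg (fun f => wh 0 f 1) (rot_smul rfl c a)).trans (wh_smul _ _ _ _ _) }
  right :=
    { toFun := fun a => wh (P := P.toPlanarStarAlgebra) 1 a 0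
      map_add' := fun a b => wh_add _ _ _ _ _
      map_smul' := fun c a => wh_smul _ _ _ _ _ }
  E :=
    { toFun := fun z => leftCap rfl z
      map_add' := fun a b => leftCap_add rfl a b
      map_smul' := fun c a => leftCap_smul rfl c a }
  τ :=
    { toFun := fun a => P.trace s (P.closeUp a)
      map_add' := fun a b => by rw [closeUp_add, map_add]
      map_smul' := fun c a => by rw [closeUp_smul, map_smul, RingHom.id_apply] }
  left_mul := fun a b =>
    (congrArg (fun f => wh 0 f 1) (rot_comp rfl a b)).trans (wh_comp _ _ _ _ _ _)
  left_star := fun a => ((adj_wh _ _ _ _).trans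
    (congrArg (fun f => wh 0 f 1) (adj_rot rfl a))).symm
  right_mul := fun a b => wh_comp _ _ _ _ _ _
  right_star := fun a => (adj_wh _ _ _ _).symm
  left_right := fun a b => by
    change wh 0 (rot rfl a) 1 ≫[2] wh 1 b 0 = wh 1 b 0 ≫[2] wh 0 (rot rfl a) 1
    rw [exch 0 (rot rfl a) b] <;> rfl
  E_right_mul := fun a z => leftCap_comp_left rfl a z
  E_mul_right := fun a z => leftCap_comp_right rfl a z
  E_left_comm := fun a z => leftCap_comm rfl _ z
  E_nonneg := leftCap_mul_star_nonneg
  E_faithful := eq_zero_of_leftCap_eq_zero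
  τ_comm := fun a b => congrArg (P.trace s) (closeUp_comp_comm a b)
  τ_faithful := fun a h => by
    by_contra ha
    exact trace_closeUp_ne_zero ha h

theorem transfer_eq_convLeft (X : P.Box (!s) 2) (y : P.Box s 1) :
    (boxExpectation P s).transfer X y = convLeft y X := by
  rw [convLeft_eq, convL_eq_leftCap]
  rfl

theorem fourier_injective : Function.Injective (fourier (P := P) (s := s)) := fun x y h => by
  rw [fourier_eq, fourier_eq] at h
  exact quarter_injective rfl h

theorem fourier_mul_pair_one_bar (x : P.Box s 2) (v : P.Box s 1) :
    fourier (x * pair 1 (bar v)) = (boxExpectation P s).right v * fourier x := by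
  rw [fourier_eq, fourier_eq, pair_one_left]
  exact quarter_comp_right_top rfl v x

theorem fourier_pair_one_bar_mul (x : P.Box s 2) (v : P.Box s 1) :
    fourier (pair 1 (bar v) * x) = (boxExpectation P s).left v * fourier x := by
  rw [fourier_eq, fourier_eq, pair_one_left]
  exact quarter_comp_right_bottom rfl _ x

theorem fourier_mul_pair_one (x : P.Box s 2) (v : P.Box s 1) :
    fourier (x * pair v 1) = fourier x * (boxExpectation P s).right v := by
  rw [fourier_eq, fourier_eq, pair_one_right]
  exact quarter_comp_left_top rfl v x

theorem fourier_pair_one_mul (x : P.Box s 2) (v : P.Box s 1) :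
    fourier (pair v 1 * x) = fourier x * (boxExpectation P s).left v := by
  rw [fourier_eq, fourier_eq, pair_one_right]
  exact quarter_comp_left_bottom rfl v x

theorem pair_eq_mul (y : P.Box s 1) (z : P.Box (!s) 1) : pair y z = pair y 1 * pair 1 z := by
  rw [pair_one_right, pair_one_left, pair_eq]
  rfl

/-- Each of the four legs of `x` carries a copy of `p` or its rotation, and the quarter turn makes
these the left and right actions of `p` on both sides of the transform. -/
theorem fourier_cutDown (x : P.Box s 2) (p : P.Box s 1) :
    fourier (cutDown x p) = (boxExpectation P s).cut p (fourier x) := by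
  rw [cutDown, pair_eq_mul, ← mul_assoc, fourier_mul_pair_one_bar, fourier_mul_pair_one, mul_assoc,
    fourier_pair_one_mul, fourier_pair_one_bar_mul, BimoduleExpectation.cut]
  simp only [mul_assoc, BimoduleExpectation.left_right]

theorem mem_exchangeA_cutDown (x : P.Box s 2) (p v : P.Box s 1) :
    v ∈ exchangeA (cutDown x p) ↔ (boxExpectation P s).right v * (boxExpectation P s).cut p
      (fourier x) = (boxExpectation P s).left v * (boxExpectation P s).cut p (fourier x) := by
  rw [← fourier_cutDown, ← fourier_mul_pair_one_bar, ← fourier_pair_one_bar_mul,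
    fourier_injective.eq_iff]
  rfl

theorem mem_exchangeB_cutDown (x : P.Box s 2) (p v : P.Box s 1) :
    v ∈ exchangeB (cutDown x p) ↔ (boxExpectation P s).cut p (fourier x) *
      (boxExpectation P s).left v = (boxExpectation P s).cut p (fourier x) *
        (boxExpectation P s).right v := by
  rw [← fourier_cutDown, ← fourier_mul_pair_one, ← fourier_pair_one_mul,
    fourier_injective.eq_iff, eq_comm]
  rfl

theorem unbar_mul (y z : P.Box (!s) 1) : unbar (y * z) = unbar z * unbar y :=
  rot_comp (Bool.not_not s).symm y z

theorem unbar_star (y : P.Box (!s) 1) : unbar (star y) = star (unbar y) :=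
  (adj_rot (Bool.not_not s).symm y).symm

theorem unbar_smul (c : ℂ) (y : P.Box (!s) 1) : unbar (c • y) = c • unbar y :=
  rot_smul (Bool.not_not s).symm c y

theorem unbar_nonneg {y : P.Box (!s) 1} (hy : 0 ≤ y) : 0 ≤ unbar y := by
  obtain ⟨b, rfl⟩ := CStarAlgebra.nonneg_iff_eq_mul_star_self.mp hy
  rw [unbar_mul, unbar_star]
  exact star_mul_self_nonneg _

/-- For the trace pairing, left convolution is dual to right convolution; a right eigenvector thus
becomes an eigenfunctional of the transfer map. -/
theorem trace_transfer_mul_unbar (X : P.Box (!s) 2) (a : P.Box s 1) (w : P.Box (!s) 1) :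
    (boxExpectation P s).τ ((boxExpectation P s).transfer X a * unbar w)
      = (boxExpectation P s).τ (a * unbar (convRight X w)) := by
  rw [transfer_eq_convLeft, convLeft_eq, convRight_eq (Bool.not_not s).symm]
  exact congrArg (P.trace s) ((closeUp_comp_rot rfl (Bool.not_not s).symm _ w).trans
    ((pairing_convL rfl (Bool.not_not s).symm a X w).trans
      (closeUp_comp_rot rfl (Bool.not_not s).symm a _).symm))

end CStarPlanarAlgebra

/-! ### The two descriptions of the positive eigenvectors -/

open CStarPlanarAlgebra PositiveMap FiniteDimensionalCStar in
theorem theorem5p13 (P : CStarPlanarAlgebra.{u}) (s : Bool) (x : P.Box s 2)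
    (hx : CStarPlanarAlgebra.IsFPositive x) :
    ∃ p ζ : P.Box s 1,
      CStarPlanarAlgebra.IsMaxSupport x p ∧ CStarPlanarAlgebra.IsMaxEigenvector x p ζ ∧
      ∀ (y₁ q : P.Box (!s) 1),
        CStarPlanarAlgebra.IsRightEigenvector x y₁ →
        CStarPlanarAlgebra.IsRangeProj y₁ q →
        CStarPlanarAlgebra.MeetZero p (1 - CStarPlanarAlgebra.unbar q) →
        CStarPlanarAlgebra.positivePart (CStarPlanarAlgebra.eigenspace x) =
          CStarPlanarAlgebra.positivePart
            {z | ∃ v ∈ CStarPlanarAlgebra.exchangeA (CStarPlanarAlgebra.cutDown x p), z = v * ζ} ∧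
        CStarPlanarAlgebra.positivePart (CStarPlanarAlgebra.eigenspace x) =
          CStarPlanarAlgebra.positivePart
            {z | ∃ v ∈ CStarPlanarAlgebra.exchangeB (CStarPlanarAlgebra.cutDown x p), z = ζ * v} := by
  obtain ⟨a, ha⟩ := hx
  set D := boxExpectation P s with hD
  set r := specRadius x with hr
  have hr0 : 0 ≤ r := ENNReal.toReal_nonneg
  set T := D.transfer (a * star a) with hT
  have hTconv (y : P.Box s 1) : convLeft y (fourier x) = T y := by
    rw [hT, ← ha, hD, transfer_eq_convLeft]
  have hTpos : ∀ y, 0 ≤ y → 0 ≤ T y := fun y hy => D.transfer_nonneg a hy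
  have hmem (y : P.Box s 1) : y ∈ positivePart (eigenspace x) ↔ T y = (r : ℂ) • y ∧ 0 ≤ y := by
    rw [positivePart, Set.mem_ofPred_eq, isPos_iff, eigenspace, Set.mem_ofPred_eq, hTconv]
  obtain ⟨p, ζ, η, hp, ⟨y₀, k, hy₀, hTy₀, hpy₀, hk⟩, hmax, hcorner, ⟨S, hS, hlim⟩, hζ, hTζ, hζη,
    hηζ, hζp, hηp⟩ := exists_maximal_support hTpos hr0
  have hps : star p = p := hp.isSelfAdjoint
  have hζs : star ζ = ζ := (IsSelfAdjoint.of_nonneg hζ).star_eq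
  refine ⟨p, ζ, ⟨⟨y₀, (hmem y₀).mpr ⟨hTy₀, hy₀⟩, hp, hpy₀, fun f hf hfy => ?_⟩,
    fun y hy q hq => hq.2.2 p hp (hmax y ((hmem y).mp hy).2 ((hmem y).mp hy).1)⟩,
    ⟨S, fun z hz => ?_, hlim⟩, ?_⟩
  · have h : f * p = p := by rw [← hk, ← mul_assoc, hfy]
    have h' := congrArg star h
    rwa [star_mul, hps, hf.isSelfAdjoint.star_eq] at h'
  · have e : (fun y => convLeft y (fourier x)) = T := funext hTconv
    simp only [e, ← Module.End.pow_apply]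
    exact hS z hz
  · intro y₁ q hy₁ hq hmeet
    have hy₁0 : 0 ≤ y₁ := (isPos_iff y₁).mp hy₁.2.1
    have hinv (b : P.Box s 1) : D.τ (T b * unbar y₁) = r * D.τ (b * unbar y₁) := by
      rw [hT, ← ha, hD, trace_transfer_mul_unbar, hy₁.2.2, unbar_smul, mul_smul_comm, map_smul,
        smul_eq_mul]
    -- The range projection `q` lies under the support `q₀ = k₁ y₁`. Rotation reverses products, so
    -- `unbar q` starts with the factor `unbar y₁`, and `e` annihilates it.
    have hmeet' (e : P.Box s 1) (he : IsStarProjection e) (hep : e * p = e)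
        (hew : e * unbar y₁ = 0) : e = 0 := by
      refine hmeet e he hep ?_
      obtain ⟨q₀, k₁, -, hq₀, hq₀y, -, -, hk₁, -⟩ := exists_support hy₁0
      have h₁ := congrArg unbar (hq.2.2 q₀ hq₀ hq₀y)
      rw [unbar_mul, ← hk₁, unbar_mul] at h₁
      rw [mul_sub, mul_one, ← h₁, ← mul_assoc, ← mul_assoc, hew, zero_mul, zero_mul, sub_zero]
    have hforward (y : P.Box s 1) (hy : y ∈ positivePart (eigenspace x)) :
        y * η ∈ exchangeA (cutDown x p) ∧ y = y * η * ζ := by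
      obtain ⟨hTy, hy0⟩ := (hmem y).mp hy
      have hpy := hmax y hy0 hTy
      have := D.exchange_of_eigenvector hζ hTζ hζη hηζ hηp hcorner (unbar_nonneg hy₁0) hinv hmeet'
        ⟨hpy, mul_eq_self_comm' hy0 hp.isSelfAdjoint hpy⟩ (IsSelfAdjoint.of_nonneg hy0).star_eq hTy
      rwa [mem_exchangeA_cutDown, ha]
    have hbackward (v : P.Box s 1) (hv : v ∈ exchangeA (cutDown x p)) (h0 : 0 ≤ v * ζ) :
        T (v * ζ) = (r : ℂ) • (v * ζ) := by
      rw [mem_exchangeA_cutDown, ha] at hv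
      exact D.eigenvector_of_exchange hps hζp hTζ hcorner hv (IsSelfAdjoint.of_nonneg h0).star_eq
    have hAB (v : P.Box s 1) : v ∈ exchangeB (cutDown x p) ↔ star v ∈ exchangeA (cutDown x p) := by
      rw [mem_exchangeA_cutDown, mem_exchangeB_cutDown, ha]
      exact D.exchange_star (D.star_cut p hps a) v
    constructor
    · ext y
      constructor
      · intro hy
        exact ⟨⟨y * η, (hforward y hy).1, (hforward y hy).2⟩, hy.2⟩
      · rintro ⟨⟨v, hv, rfl⟩, hpos⟩
        have h0 := (isPos_iff _).mp hpos
        exact (hmem _).mpr ⟨hbackward v hv h0, h0⟩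
    · ext y
      constructor
      · intro hy
        obtain ⟨h₁, h₂⟩ := hforward y hy
        refine ⟨⟨star (y * η), by rwa [hAB, star_star], ?_⟩, hy.2⟩
        have h₃ := congrArg star h₂
        rwa [star_mul, hζs, (IsSelfAdjoint.of_nonneg ((hmem y).mp hy).2).star_eq] at h₃
      · rintro ⟨⟨v, hv, rfl⟩, hpos⟩
        have h0 := (isPos_iff _).mp hpos
        -- Positivity makes `ζ v` self-adjoint, so it equals its adjoint, which has the form treated
        -- for `𝒜_p`.
        have h₁ : ζ * v = star v * ζ := by
          have := (IsSelfAdjoint.of_nonneg h0).star_eq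
          rwa [star_mul, hζs, eq_comm] at this
        rw [h₁] at h0 ⊢
        exact (hmem _).mpr ⟨hbackward _ ((hAB v).mp hv) h0, h0⟩
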